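/- Let $A$ be a set of $m\ge 1$ applicants (rows) and $B$ a set of $n$ houses (elements). An instance is an $m\times k$ matrix $M$ with entries in $B$ in which no row contains an element twice; row $r$ is the preference list of applicant $r$, most preferred element first (complete lists are the case $k=n$; for $k<n$ the lists are truncated). A matching $\tau$ assigns to every row one of its positions, or leaves the row unassigned, such that no element is selected by two rows; every row prefers each of its positions to being unassigned. A blocking coalition of $\tau$ is a non-empty set $A'$ of rows for which there is a matching $\tau'$ that agrees with $\tau$ outside $A'$ and is strictly better than $\tau$ for every row of $A'$. A Pareto optimal matching (POM) is a matching without a blocking coalition. (If $k\ge m$, every POM assigns all rows.) Let $s(\tau)$ be the set of elements selected by $\tau$. An element $b\in B$ is avoidable if $b\notin s(\tau)$ for some POM $\tau$, and unavoidable if $b\in s(\tau)$ for every POM $\tau$. The model of computation is a deterministic random access machine with registers and finitely many arrays, on words of $O(\log(m+n))$ bits, in which each addition, truncated subtraction, multiplication, comparison, memory access and test costs one step. The numbers $m,k,n$ (and $x$, if there is one) are given in registers, the matrix $M$ is given row by row in an array, and all other memory is initially zero. Then, with absolute constants in the $O$-notation, for all $m\ge 1$, all $n\ge 1$, all $k$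 and all such $M$: 1. Deciding, for given $M$ and $x\in B$, whether $x$ is avoidable can be done in time $O(m^2\sqrt{m+n})$. 2. The same can be done in time $O(m^3)$. 3. Listing all unavoidable elements of a given $M$ (each of them once) can be done in time $O(m^2n\sqrt{m+n})$. 4. The same can be done in time $O(m^5)$. -/

import Mathlib

namespace HouseAllocation

/-! ### Preference matrices and Pareto optimal matchings -/

/-- An `m × k` preference matrix over the elements (houses) `Fin n`: row `r` is the preference list
of applicant `r`, most preferred element first, and contains no element twice.  Complete preference
lists (total orders of `Fin n`) are the case `k = n`. -/
structure PrefMatrix (m k n : ℕ) where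
  entry : Fin m → Fin k → Fin n
  row_injective : ∀ r, Function.Injective (entry r)

variable {m k n : ℕ}

/-- An assignment gives every row the column of the position it selects, or `⊤` if the row is not
assigned.  Smaller is better, and every position of a row is better than being unassigned. -/
abbrev Assignment (m k : ℕ) := Fin m → WithTop (Fin k)

/-- A matching: no element is selected by two different rows. -/
def IsMatching (M : PrefMatrix m k n) (τ : Assignment m k) : Prop :=
  ∀ (r r' : Fin m) (c c' : Fin k), τ r = (c : WithTop (Fin k)) → τ r' = (c' : WithTop (Fin k)) →
    M.entry r c = M.entry r' c' → r = r'

/-- `S` is a blocking coalition of `τ`. -/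
def IsBlockingCoalition (M : PrefMatrix m k n) (τ : Assignment m k) (S : Set (Fin m)) : Prop :=
  S.Nonempty ∧ ∃ τ' : Assignment m k, IsMatching M τ' ∧
    (∀ r, r ∉ S → τ' r = τ r) ∧ ∀ r, r ∈ S → τ' r < τ r

/-- Pareto optimal matchings. -/
def IsPOM (M : PrefMatrix m k n) (τ : Assignment m k) : Prop :=
  IsMatching M τ ∧ ∀ S : Set (Fin m), ¬ IsBlockingCoalition M τ S

/-- The set `s(τ)` of elements selected by `τ`. -/
def selected (M : PrefMatrix m k n) (τ : Assignment m k) : Set (Fin n) :=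
  {b | ∃ (r : Fin m) (c : Fin k), τ r = (c : WithTop (Fin k)) ∧ M.entry r c = b}

/-- Some Pareto optimal matching does not select `b`. -/
def Avoidable (M : PrefMatrix m k n) (b : Fin n) : Prop :=
  ∃ τ, IsPOM M τ ∧ b ∉ selected M τ

/-- Every Pareto optimal matching selects `b`. -/
def Unavoidable (M : PrefMatrix m k n) (b : Fin n) : Prop :=
  ∀ τ, IsPOM M τ → b ∈ selected M τ

/-! ### A random access machine with unit-cost steps on machine words

Programs are finite structured programs over registers and finitely many random access arrays.
They are deterministic, and every operation, memory access and test costs one step.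
A number `W` bounds the machine words: a computation that produces a value `≥ W` (also as an
intermediate result or as an address) has no execution. -/

/-- The contents of the registers and of the arrays. -/
structure State where
  reg : ℕ → ℕ
  arr : ℕ → ℕ → ℕ

/-- Word operations. Subtraction is truncated; comparisons return `1` or `0`. -/
inductive Op
  | add | sub | mul | lt | eq

/-- The value of a word operation. -/
def Op.apply : Op → ℕ → ℕ → ℕ
  | .add, a, b => a + b
  | .sub, a, b => a - b
  | .mul, a, b => a * b
  | .lt, a, b => if a < b then 1 else 0
  | .eq, a, b => if a = b then 1 else 0

/-- Expressions: constants, registers, array look-ups and word operations. -/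
inductive Expr
  | const (c : ℕ)
  | reg (x : ℕ)
  | load (a : ℕ) (e : Expr)
  | bin (o : Op) (e f : Expr)

/-- The value of an expression. -/
def Expr.eval (s : State) : Expr → ℕ
  | .const c => c
  | .reg x => s.reg x
  | .load a e => s.arr a (e.eval s)
  | .bin o e f => o.apply (e.eval s) (f.eval s)

/-- The number of steps taken by evaluating an expression. -/
def Expr.cost : Expr → ℕ
  | .const _ => 1
  | .reg _ => 1
  | .load _ e => e.cost + 1
  | .bin _ e f => e.cost + f.cost + 1

/-- All values that occur in evaluating the expression are machine words. -/
def Expr.Fits (W : ℕ) (s : State) : Expr → Prop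
  | .const c => c < W
  | .reg x => s.reg x < W
  | .load a e => e.Fits W s ∧ s.arr a (e.eval s) < W
  | .bin o e f => e.Fits W s ∧ f.Fits W s ∧ o.apply (e.eval s) (f.eval s) < W

/-- Programs. -/
inductive Prog
  | skip
  | assign (x : ℕ) (e : Expr)
  | store (a : ℕ) (e f : Expr)
  | comp (p q : Prog)
  | cond (e : Expr) (p q : Prog)
  | loop (e : Expr) (p : Prog)

/-- Write `v` into register `x`. -/
def State.setReg (s : State) (x v : ℕ) : State :=
  { s with reg := Function.update s.reg x v }

/-- Write `v` into cell `i` of array `a`. -/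
def State.setArr (s : State) (a i v : ℕ) : State :=
  { s with arr := Function.update s.arr a (Function.update (s.arr a) i v) }

/-- `Exec W p s t s'`: with machine words below `W`, the program `p` started in state `s` halts
after `t` steps in state `s'`. In tests, zero is false and everything else is true. -/
inductive Exec (W : ℕ) : Prog → State → ℕ → State → Prop
  | skip (s : State) : Exec W .skip s 1 s
  | assign (s : State) (x : ℕ) (e : Expr) (he : e.Fits W s) :
      Exec W (.assign x e) s (e.cost + 1) (s.setReg x (e.eval s))
  | store (s : State) (a : ℕ) (e f : Expr) (he : e.Fits W s) (hf : f.Fits W s) :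
      Exec W (.store a e f) s (e.cost + f.cost + 1) (s.setArr a (e.eval s) (f.eval s))
  | comp {p q : Prog} {s s' s'' : State} {t t' : ℕ}
      (hp : Exec W p s t s') (hq : Exec W q s' t' s'') : Exec W (.comp p q) s (t + t') s''
  | cond_true {e : Expr} {p q : Prog} {s s' : State} {t : ℕ} (he : e.Fits W s)
      (h : e.eval s ≠ 0) (hp : Exec W p s t s') : Exec W (.cond e p q) s (e.cost + 1 + t) s'
  | cond_false {e : Expr} {p q : Prog} {s s' : State} {t : ℕ} (he : e.Fits W s)
      (h : e.eval s = 0) (hq : Exec W q s t s') : Exec W (.cond e p q) s (e.cost + 1 + t) s'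
  | loop_true {e : Expr} {p : Prog} {s s' s'' : State} {t t' : ℕ} (he : e.Fits W s)
      (h : e.eval s ≠ 0) (hp : Exec W p s t s') (hl : Exec W (.loop e p) s' t' s'') :
      Exec W (.loop e p) s (e.cost + 1 + t + t') s''
  | loop_false {e : Expr} {p : Prog} {s : State} (he : e.Fits W s) (h : e.eval s = 0) :
      Exec W (.loop e p) s (e.cost + 1) s

/-! ### The two algorithmic problems -/

/-- The initial state for the matrix `M` and a further input word `x`: registers `0, 1, 2, 3` hold
`m, k, n, x`, array `0` holds `M` row by row (the entry in row `r` and column `c` is in cell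
`c + k * r`), and everything else is zero. -/
def inputState (M : PrefMatrix m k n) (x : ℕ) : State where
  reg := fun i => if i = 0 then m else if i = 1 then k else if i = 2 then n
    else if i = 3 then x else 0
  arr := fun a i => if h : a = 0 ∧ i < m * k then
      (M.entry (finProdFinEquiv.symm ⟨i, h.2⟩).1 (finProdFinEquiv.symm ⟨i, h.2⟩).2 : ℕ)
    else 0

/-- The program `p` decides in time `O(f(m, n))`, on machine words of `O(log (m + n))` bits, whether
a given element `x` of a given matrix is avoidable; the answer (`1` for yes, `0` for no) is left in
register `0`. -/
def DecidesAvoidable (p : Prog) (f : ℕ → ℕ → ℝ) : Prop :=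
  ∃ (C : ℝ) (d : ℕ), ∀ (m k n : ℕ), 0 < m → ∀ (M : PrefMatrix m k n) (x : Fin n),
    ∃ (t : ℕ) (s : State), Exec ((m + n) ^ d) p (inputState M x) t s ∧ (t : ℝ) ≤ C * f m n ∧
      ((Avoidable M x ∧ s.reg 0 = 1) ∨ (¬ Avoidable M x ∧ s.reg 0 = 0))

/-- The program `p` lists in time `O(f(m, n))`, on machine words of `O(log (m + n))` bits, all
unavoidable elements of a given matrix, each of them once: their number is left in register `0`, and
they are left in the first cells of array `1`. -/
def ListsUnavoidable (p : Prog) (f : ℕ → ℕ → ℝ) : Prop :=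
  ∃ (C : ℝ) (d : ℕ), ∀ (m k n : ℕ), 0 < m → 0 < n → ∀ (M : PrefMatrix m k n),
    ∃ (t : ℕ) (s : State), Exec ((m + n) ^ d) p (inputState M 0) t s ∧ (t : ℝ) ≤ C * f m n ∧
      ∃ L : List (Fin n), L.Nodup ∧ (∀ b, b ∈ L ↔ Unavoidable M b) ∧
        s.reg 0 = L.length ∧ ∀ (i : ℕ) (hi : i < L.length), s.arr 1 i = (L[i] : ℕ)

end HouseAllocation

namespace HouseAllocation

/-! ### Weakest preconditions for the random access machine -/

attribute [simp] Expr.eval Expr.cost Expr.Fits Op.apply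

/-! Avoidability is a bipartite matching question. In a POM that avoids `x`, a row listing `x` must
hold something it prefers to `x`, since otherwise it could simply take `x`. Conversely, match the
rows that list `x` to elements they prefer to `x`, leave the other rows unassigned, and improve this
to a POM: improvement never moves a row back to `x`, and a row entering from outside never reaches a
position of index `m` or more. Only the first `min m k` columns therefore matter (`IsPOM.lt_of_le`),
and `x` is avoidable iff the rows listing `x` there can all be matched to earlier entries
(`avoidable_iff_saturable`, up to the degenerate case `k = 0`).

The resulting graph has at most `m` rows and at most `m ^ 2` edges. With `L` the square root of `m`
rounded up, a matching of all active rows is found or refuted in `O(m ^ 2 * L)` steps, in two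
phases.

The auction: a row bids for a cheapest neighbour, pays one more than its price and evicts the
holder; a row all of whose neighbours cost at least `L` gives up. Free elements cost nothing and at
most `m` elements are held, so there are at most `m * L` bids, each costing `O(m)`. If all active
rows can be matched, then at most `m / L` rows give up (`Auction.cnt_mul_le`): a holder of an
element of price at least `j + 1`, and every row that gave up, has only neighbours of price at least
`j`, so each price level contains at least `cnt` fewer elements than the level below.

Augmentation: if `cnt * L > m`, the answer is no. Otherwise `cnt ≤ L`, because `m ≤ L * L`, and one
breadth-first search of cost `O(m ^ 2)` per remaining row either places it or violates Hall's
condition (`SearchTree.not_sat`).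

No pass touches all `n` elements, so the cost is free of `n`. As `L ≤ m` and `L ≤ 2 * √(m + n)`, one
program meets both bounds for the decision. For the listing, elements outside the first `min m k`
columns are avoidable; at most `min n (m ^ 2)` candidates remain, and each is decided once. -/

@[simp] theorem State.setReg_reg (s : State) (x v y : ℕ) :
    (s.setReg x v).reg y = if y = x then v else s.reg y := by
  simp [State.setReg, Function.update_apply]

@[simp] theorem State.setReg_arr (s : State) (x v : ℕ) : (s.setReg x v).arr = s.arr := rfl

@[simp] theorem State.setArr_reg (s : State) (a i v : ℕ) : (s.setArr a i v).reg = s.reg := rfl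

@[simp] theorem State.setArr_arr (s : State) (a i v b : ℕ) :
    (s.setArr a i v).arr b = if b = a then Function.update (s.arr a) i v else s.arr b := by
  simp only [State.setArr, Function.update_apply]

theorem Op.lt_apply_le (a b : ℕ) : Op.lt.apply a b ≤ 1 := by
  simp only [Op.apply]
  split_ifs <;> decide

/-- The program `p` started in `s` halts, and the final state and the number of steps
satisfy `Q`. -/
def wp (W : ℕ) (p : Prog) (s : State) (Q : State → ℕ → Prop) : Prop :=
  ∃ t s', Exec W p s t s' ∧ Q s' t

variable {W : ℕ} {p q : Prog} {s : State} {Q Q' : State → ℕ → Prop} {e : Expr}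

theorem wp.mono (h : wp W p s Q) (hQ : ∀ s' t, Q s' t → Q' s' t) : wp W p s Q' := by
  obtain ⟨t, s', hx, hq⟩ := h
  exact ⟨t, s', hx, hQ _ _ hq⟩

-- Inversion on the rules of `Exec`. As equivalences, this lemma and the following ones let `simp`
-- execute straight-line code symbolically; loops need `wp_loop`.
@[simp] theorem wp_skip : wp W .skip s Q ↔ Q s 1 := by
  constructor
  · rintro ⟨t, s', h, hq⟩
    cases h
    exact hq
  · exact fun h => ⟨_, _, .skip s, h⟩

@[simp] theorem wp_assign {x : ℕ} :
    wp W (.assign x e) s Q ↔ e.Fits W s ∧ Q (s.setReg x (e.eval s)) (e.cost + 1) := by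
  constructor
  · rintro ⟨t, s', h, hq⟩
    cases h with
    | assign _ _ _ he => exact ⟨he, hq⟩
  · exact fun h => ⟨_, _, .assign s x e h.1, h.2⟩

@[simp] theorem wp_store {a : ℕ} {f : Expr} :
    wp W (.store a e f) s Q ↔ e.Fits W s ∧ f.Fits W s ∧
      Q (s.setArr a (e.eval s) (f.eval s)) (e.cost + f.cost + 1) := by
  constructor
  · rintro ⟨t, s', h, hq⟩
    cases h with
    | store _ _ _ _ he hf => exact ⟨he, hf, hq⟩
  · exact fun h => ⟨_, _, .store s a e f h.1 h.2.1, h.2.2⟩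

@[simp] theorem wp_comp :
    wp W (.comp p q) s Q ↔ wp W p s fun s' t => wp W q s' fun s'' t' => Q s'' (t + t') := by
  constructor
  · rintro ⟨t, s', h, hq⟩
    cases h with
    | comp h1 h2 => exact ⟨_, _, h1, _, _, h2, hq⟩
  · rintro ⟨t, s', h1, t', s'', h2, hq⟩
    exact ⟨_, _, .comp h1 h2, hq⟩

@[simp] theorem wp_cond :
    wp W (.cond e p q) s Q ↔ e.Fits W s ∧
      (e.eval s ≠ 0 → wp W p s fun s' t => Q s' (e.cost + 1 + t)) ∧
      (e.eval s = 0 → wp W q s fun s' t => Q s' (e.cost + 1 + t)) := by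
  constructor
  · rintro ⟨t, s', h, hq⟩
    cases h with
    | cond_true he hn hp => exact ⟨he, fun _ => ⟨_, _, hp, hq⟩, fun h0 => absurd h0 hn⟩
    | cond_false he hn hp => exact ⟨he, fun h0 => absurd hn h0, fun _ => ⟨_, _, hp, hq⟩⟩
  · rintro ⟨he, h1, h2⟩
    by_cases h0 : e.eval s = 0
    · obtain ⟨t, s', h, hq⟩ := h2 h0
      exact ⟨_, _, .cond_false he h0 h, hq⟩
    · obtain ⟨t, s', h, hq⟩ := h1 h0
      exact ⟨_, _, .cond_true he h0 h, hq⟩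

/-- Total correctness of a loop: `I s t` is an invariant of the state `s` and the number `t` of
steps so far, and `V` is a variant. -/
theorem wp_loop (I : State → ℕ → Prop) (V : State → ℕ) (hI : I s 0)
    (hfit : ∀ s t, I s t → e.Fits W s)
    (hbody : ∀ s t, I s t → e.eval s ≠ 0 →
      wp W p s fun s' t' => I s' (t + (e.cost + 1) + t') ∧ V s' < V s) :
    wp W (.loop e p) s fun s' t => ∃ t₀, t = t₀ + (e.cost + 1) ∧ I s' t₀ ∧ e.eval s' = 0 := by
  -- The time already spent is generalised, so that the invariant can speak of the total time while
  -- the induction runs on a bound for the variant.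
  suffices H : ∀ N s t, V s < N → I s t →
      wp W (.loop e p) s fun s' t' => ∃ t₀, t + t' = t₀ + (e.cost + 1) ∧ I s' t₀ ∧
        e.eval s' = 0 by
    refine (H _ s 0 (Nat.lt_succ_self _) hI).mono fun s' t' => ?_
    simp
  intro N
  induction N with
  | zero => exact fun s t h => absurd h (Nat.not_lt_zero _)
  | succ N ih =>
    intro s t hV hI
    by_cases h0 : e.eval s = 0
    · exact ⟨_, _, .loop_false (hfit s t hI) h0, t, rfl, hI, h0⟩
    · obtain ⟨t₁, s₁, h1, hI1, hV1⟩ := hbody s t hI h0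
      obtain ⟨t₂, s₂, h2, t₀, ht, hI2, he2⟩ := ih s₁ _ (by omega) hI1
      exact ⟨_, _, .loop_true (hfit s t hI) h0 h1 h2, t₀, by omega, hI2, he2⟩

/-- The registers that a program may write. -/
def Prog.wregs : Prog → List ℕ
  | .skip => []
  | .assign x _ => [x]
  | .store _ _ _ => []
  | .comp p q => p.wregs ++ q.wregs
  | .cond _ p q => p.wregs ++ q.wregs
  | .loop _ p => p.wregs

/-- The arrays that a program may write. -/
def Prog.warrs : Prog → List ℕ
  | .skip => []
  | .assign _ _ => []
  | .store a _ _ => [a]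
  | .comp p q => p.warrs ++ q.warrs
  | .cond _ p q => p.warrs ++ q.warrs
  | .loop _ p => p.warrs

/-- The states `s` and `s'` agree wherever `p` does not write. -/
structure Frame (p : Prog) (s s' : State) : Prop where
  reg : ∀ i, i ∉ p.wregs → s'.reg i = s.reg i
  arr : ∀ a, a ∉ p.warrs → s'.arr a = s.arr a

/-- Specifications need only mention what a program changes: `wregs` and `warrs` are computable, so
that everything else is preserved is checked by `decide`. -/
theorem Exec.frame {s' : State} {t : ℕ} (h : Exec W p s t s') : Frame p s s' := by
  induction h with
  | skip | loop_false => exact ⟨fun _ _ => rfl, fun _ _ => rfl⟩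
  | assign s x e =>
    refine ⟨fun i hi => ?_, fun _ _ => rfl⟩
    simp only [Prog.wregs, List.mem_singleton] at hi
    simp [hi]
  | store s a e f =>
    refine ⟨fun _ _ => rfl, fun i hi => ?_⟩
    simp only [Prog.warrs, List.mem_singleton] at hi
    simp [hi]
  | comp _ _ h1 h2 =>
    refine ⟨fun i hi => ?_, fun i hi => ?_⟩
    · simp only [Prog.wregs, List.mem_append, not_or] at hi
      rw [h2.reg i hi.2, h1.reg i hi.1]
    · simp only [Prog.warrs, List.mem_append, not_or] at hi
      rw [h2.arr i hi.2, h1.arr i hi.1]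
  | cond_true _ _ _ h =>
    refine ⟨fun i hi => h.reg i fun h' => hi ?_, fun i hi => h.arr i fun h' => hi ?_⟩
    · simp [Prog.wregs, h']
    · simp [Prog.warrs, h']
  | cond_false _ _ _ h =>
    refine ⟨fun i hi => h.reg i fun h' => hi ?_, fun i hi => h.arr i fun h' => hi ?_⟩
    · simp [Prog.wregs, h']
    · simp [Prog.warrs, h']
  | loop_true _ _ _ _ h1 h2 =>
    exact ⟨fun i hi => (h2.reg i hi).trans (h1.reg i hi),
      fun i hi => (h2.arr i hi).trans (h1.arr i hi)⟩

theorem wp.frame (h : wp W p s Q) : wp W p s fun s' t => Q s' t ∧ Frame p s s' := by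
  obtain ⟨t, s', hx, hq⟩ := h
  exact ⟨t, s', hx, hq, hx.frame⟩

/-- Using a specification of a subprogram, with its frame. -/
theorem wp.frame_mono (h : wp W p s Q) (hQ : ∀ s' t, Q s' t → Frame p s s' → Q' s' t) :
    wp W p s Q' :=
  h.frame.mono fun s' t h => hQ s' t h.1 h.2

/-- Increment a register. -/
def incr (i : ℕ) : Prog := .assign i (.bin .add (.reg i) (.const 1))

/-- `for i := 0, …, b - 1 do p`, where `b` is the content of a register. -/
def forLoop (i b : ℕ) (p : Prog) : Prog :=
  .comp (.assign i (.const 0)) (.loop (.bin .lt (.reg i) (.reg b)) (.comp p (incr i)))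

@[simp] theorem wp_incr {i : ℕ} :
    wp W (incr i) s Q ↔
      (s.reg i < W ∧ 1 < W ∧ s.reg i + 1 < W) ∧ Q (s.setReg i (s.reg i + 1)) 4 := by
  simp [incr]

/-- The rule for counting loops, with an invariant on the state and the time. -/
theorem wp_forLoop {i b N : ℕ} (I : ℕ → State → ℕ → Prop) (hib : b ≠ i) (hi : i ∉ p.wregs)
    (hb : b ∉ p.wregs) (hN : s.reg b = N) (hW : N + 1 < W) (h0 : I 0 (s.setReg i 0) 0)
    (hbody : ∀ j s t, j < N → s.reg i = j → s.reg b = N → I j s t →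
      wp W p s fun s' t' => I (j + 1) (s'.setReg i (j + 1)) (t + t' + 8)) :
    wp W (forLoop i b p) s fun s' t => ∃ t₀, t = t₀ + 6 ∧ I N s' t₀ := by
  -- Each round adds 8 steps: 4 for the test and 4 for the increment. The final 6 are 2 for setting
  -- the counter to zero and 4 for the failing test.
  simp only [forLoop, wp_comp, wp_assign]
  refine ⟨by simp; omega, ?_⟩
  refine (wp_loop (fun s t => s.reg i ≤ N ∧ s.reg b = N ∧ I (s.reg i) s t)
    (fun s => N - s.reg i) ?_ ?_ ?_).mono ?_
  · simp [hib, hN, h0]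
  · rintro s t ⟨h1, h2, h3⟩
    refine ⟨by simp only [Expr.Fits]; omega, by simp only [Expr.Fits]; omega, ?_⟩
    exact (Op.lt_apply_le _ _).trans_lt (by omega)
  · rintro s t ⟨h1, h2, h3⟩ h4
    have hlt : s.reg i < N := by
      by_contra h
      simp [h2, h] at h4
    rw [wp_comp]
    refine (hbody _ s t hlt rfl h2 h3).frame_mono fun s' t' hI hf => ?_
    rw [wp_incr]
    have e1 := hf.reg i hi
    have e2 := hf.reg b hb
    refine ⟨by omega, ⟨by simp [e1]; omega, by simp [hib, e2, h2], ?_⟩, by simp [e1]; omega⟩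
    simp only [State.setReg_reg, if_true, e1, Expr.cost]
    convert hI using 1
    omega
  · rintro s' t ⟨t₀, rfl, ⟨h1, h2, h3⟩, h4⟩
    have : s'.reg i = N := by
      by_contra h
      have hlt : s'.reg i < N := by omega
      simp [h2, hlt] at h4
    rw [this] at h3
    exact ⟨t₀, by simp; omega, h3⟩

/-- The rule for counting loops whose body takes at most `T` steps each time. -/
theorem wp_forLoop_uniform {i b N T : ℕ} (I : ℕ → State → Prop) (hib : b ≠ i)
    (hi : i ∉ p.wregs) (hb : b ∉ p.wregs) (hN : s.reg b = N) (hW : N + 1 < W)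
    (h0 : I 0 (s.setReg i 0))
    (hbody : ∀ j s, j < N → s.reg i = j → s.reg b = N → I j s →
      wp W p s fun s' t' => I (j + 1) (s'.setReg i (j + 1)) ∧ t' ≤ T) :
    wp W (forLoop i b p) s fun s' t => I N s' ∧ t ≤ N * (T + 8) + 6 := by
  refine (wp_forLoop (fun j s t => I j s ∧ t ≤ j * (T + 8)) hib hi hb hN hW ⟨h0, by simp⟩
    ?_).mono ?_
  · rintro j s t hj h1 h2 ⟨h3, h4⟩
    refine (hbody j s hj h1 h2 h3).mono ?_
    rintro s' t' ⟨h5, h6⟩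
    exact ⟨h5, by rw [Nat.succ_mul]; omega⟩
  · rintro s' t ⟨t₀, rfl, h1, h2⟩
    exact ⟨h1, by omega⟩

/-! ### Avoidability as a matching problem -/

variable {m k n : ℕ}

/-- Every matching can be improved to a Pareto optimal one. -/
theorem IsMatching.exists_isPOM_le {M : PrefMatrix m k n} {τ₀ : Assignment m k}
    (h₀ : IsMatching M τ₀) : ∃ τ ≤ τ₀, IsPOM M τ := by
  have : Finite (WithTop (Fin k)) := inferInstanceAs (Finite (Option (Fin k)))
  -- Take a matching below `τ₀` that is minimal in the pointwise order; a blocking coalition would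
  -- produce a strictly smaller one.
  obtain ⟨τ, hle, hτ⟩ := (Set.toFinite {τ : Assignment m k | IsMatching M τ}).exists_le_minimal h₀
  refine ⟨τ, hle, hτ.prop, ?_⟩
  rintro S ⟨⟨r, hr⟩, τ', hM, hout, hin⟩
  have hle' : τ' ≤ τ := by
    intro r'
    by_cases h : r' ∈ S
    · exact (hin r' h).le
    · exact (hout r' h).le
  exact absurd (hτ.le_of_le hM hle' r) (not_le_of_gt (hin r hr))

/-- In a Pareto optimal matching, a row cannot move to a better element that is not selected. -/
theorem IsPOM.mem_selected_of_lt {M : PrefMatrix m k n} {τ : Assignment m k} (h : IsPOM M τ)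
    {r : Fin m} {c : Fin k} (hc : (c : WithTop (Fin k)) < τ r) : M.entry r c ∈ selected M τ := by
  by_contra hn
  refine h.2 {r} ⟨⟨r, rfl⟩, Function.update τ r c, ?_, ?_, ?_⟩
  · intro r₁ r₂ c₁ c₂ h₁ h₂ he
    by_cases e₁ : r₁ = r <;> by_cases e₂ : r₂ = r
    · rw [e₁, e₂]
    · subst e₁
      rw [Function.update_self] at h₁
      rw [Function.update_of_ne e₂] at h₂
      rw [← WithTop.coe_injective h₁] at he
      exact absurd ⟨r₂, c₂, h₂, he.symm⟩ hn
    · subst e₂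
      rw [Function.update_self] at h₂
      rw [Function.update_of_ne e₁] at h₁
      rw [← WithTop.coe_injective h₂] at he
      exact absurd ⟨r₁, c₁, h₁, he⟩ hn
    · rw [Function.update_of_ne e₁] at h₁
      rw [Function.update_of_ne e₂] at h₂
      exact h.1 _ _ _ _ h₁ h₂ he
  · intro r' hr'
    exact Function.update_of_ne hr' _ _
  · rintro r' rfl
    rwa [Function.update_self]

/-- In a Pareto optimal matching every row gets one of its first `m` positions,
if it has more than `m` of them. -/
theorem IsPOM.lt_of_le {M : PrefMatrix m k n} {τ : Assignment m k} (h : IsPOM M τ) {r : Fin m}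
    {p : Fin k} (hp : m ≤ p) : τ r < (p : WithTop (Fin k)) := by
  classical
  by_contra hn
  rw [not_lt] at hn
  -- Row `r` would prefer each of its first `m` entries to what it has, so all of them are selected.
  -- Distinct entries are selected by distinct rows, so all `m` rows are used up, including `r`
  -- itself, which then holds one of these entries after all.
  have hsel : ∀ i : Fin m, ∃ r' c', τ r' = ((c' : Fin k) : WithTop (Fin k)) ∧
      M.entry r' c' = M.entry r ⟨i, by omega⟩ := fun i =>
    h.mem_selected_of_lt (lt_of_lt_of_le (WithTop.coe_lt_coe.2 (Fin.mk_lt_of_lt_val (by omega))) hn)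
  choose f g hf hg using hsel
  have hinj : Function.Injective f := by
    intro i j hij
    have hgg : g i = g j := WithTop.coe_injective (by rw [← hf, ← hf, hij])
    have := hg i
    rw [hij, hgg, hg j] at this
    have := M.row_injective r this
    simpa [Fin.ext_iff] using this.symm
  obtain ⟨i, hi⟩ := (Finite.injective_iff_surjective.1 hinj) r
  have h1 := hf i
  rw [hi] at h1
  have h2 := hg i
  rw [hi] at h2
  have h3 := M.row_injective r h2
  rw [h1, WithTop.coe_le_coe, h3, Fin.le_def] at hn
  simp only at hn
  omega

/-- The rows that list `x` among their first `min m k` positions can be matched to elements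
that they prefer to `x`. -/
def Saturable (M : PrefMatrix m k n) (x : Fin n) : Prop :=
  ∃ σ : Fin m → Fin k, (∀ r (c : Fin k), (c : ℕ) < min m k → M.entry r c = x → σ r < c) ∧
    ∀ r r' (c c' : Fin k), (c : ℕ) < min m k → M.entry r c = x →
      (c' : ℕ) < min m k → M.entry r' c' = x → M.entry r (σ r) = M.entry r' (σ r') → r = r'

/-- In a POM avoiding `x`, every row listing `x` is strictly better off than `x`: it does not hold
`x`, and if it were worse off, `x` would have to be selected. So the POM itself is the required
matching. The alternative `k = 0` is needed because then there is no `σ : Fin m → Fin k`. -/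
theorem Avoidable.saturable {M : PrefMatrix m k n} {x : Fin n} (h : Avoidable M x) :
    k = 0 ∨ Saturable M x := by
  obtain ⟨τ, hτ, hx⟩ := h
  rcases Nat.eq_zero_or_pos k with hk | hk
  · exact Or.inl hk
  right
  have key : ∀ r (c : Fin k), M.entry r c = x → τ r < (c : WithTop (Fin k)) := by
    intro r c hc
    rcases lt_trichotomy (τ r) (c : WithTop (Fin k)) with h1 | h1 | h1
    · exact h1
    · exact absurd ⟨r, c, h1, hc⟩ hx
    · exact absurd (hc ▸ hτ.mem_selected_of_lt h1) hx
  refine ⟨fun r => (τ r).untopD ⟨0, hk⟩, fun r c _ hc => ?_, fun r r' c c' _ hc _ hc' he => ?_⟩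
  · have h1 := key r c hc
    cases h2 : τ r with
    | top => simp [h2] at h1
    | coe d => simpa [h2] using h1
  · have h1 := key r c hc
    have h1' := key r' c' hc'
    cases h2 : τ r with
    | top => simp [h2] at h1
    | coe d =>
      cases h2' : τ r' with
      | top => simp [h2'] at h1'
      | coe d' => exact hτ.1 r r' d d' h2 h2' (by simpa [h2, h2'] using he)

theorem Saturable.avoidable {M : PrefMatrix m k n} {x : Fin n} (h : Saturable M x) :
    Avoidable M x := by
  classical
  obtain ⟨σ, h1, h2⟩ := h
  let act : Fin m → Prop := fun r => ∃ c : Fin k, (c : ℕ) < min m k ∧ M.entry r c = x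
  -- Rows that do not list `x` early start unassigned; improving to a POM may assign them, but it
  -- cannot make the other rows worse.
  have hM : IsMatching M fun r => if act r then ((σ r : Fin k) : WithTop (Fin k)) else ⊤ := by
    intro r r' c c' e e' he
    simp only at e e'
    split_ifs at e e' with a a'
    · obtain ⟨d, hd, hd'⟩ := a
      obtain ⟨d₁, hd₁, hd₁'⟩ := a'
      rw [← WithTop.coe_injective e, ← WithTop.coe_injective e'] at he
      exact h2 r r' d d₁ hd hd' hd₁ hd₁' he
    all_goals simp at e e'
  obtain ⟨τ, hle, hτ⟩ := hM.exists_isPOM_le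
  refine ⟨τ, hτ, ?_⟩
  rintro ⟨r, c, hr, hc⟩
  have hcon : τ r < (c : WithTop (Fin k)) := by
    -- Either the row was matched below `x` from the start, or `x` stands at index `m` or later,
    -- which no row of a POM reaches.
    by_cases hlt : (c : ℕ) < min m k
    · have h3 : act r := ⟨c, hlt, hc⟩
      have := hle r
      simp only [h3, if_true] at this
      exact lt_of_le_of_lt this (WithTop.coe_lt_coe.2 (h1 r c hlt hc))
    · exact hτ.lt_of_le (by omega)
  exact absurd hr hcon.ne

theorem avoidable_iff_saturable {M : PrefMatrix m k n} {x : Fin n} (hk : 0 < k) :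
    Avoidable M x ↔ Saturable M x :=
  ⟨fun h => h.saturable.resolve_left hk.ne', fun h => h.avoidable⟩

/-- An element that is not among the first `min m k` positions of any row is avoidable. -/
theorem avoidable_of_forall_ne {M : PrefMatrix m k n} {x : Fin n}
    (h : ∀ r (c : Fin k), (c : ℕ) < min m k → M.entry r c ≠ x) : Avoidable M x := by
  obtain ⟨τ, -, hτ⟩ := IsMatching.exists_isPOM_le (M := M) (τ₀ := fun _ => ⊤)
    (fun r r' c c' e => by simp at e)
  refine ⟨τ, hτ, ?_⟩
  rintro ⟨r, c, hr, hc⟩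
  by_cases hlt : (c : ℕ) < min m k
  · exact h r c hlt hc
  · exact absurd hr (hτ.lt_of_le (by omega)).ne

/-! ### Passes over the first positions of all rows

Registers `0`, `1`, `3` hold `m`, `k` and the element `x`; the programs below keep `min m k` in
register `5` and a number `L` close to the square root of `m` in register `6`. -/

/-- The array `A` holds an `m × k` matrix over `n` elements without repetitions in its rows, and
the words are large enough. -/
structure Setup (W m k n : ℕ) (A : ℕ → ℕ) : Prop where
  pos : 0 < m
  entry_lt : ∀ r c, r < m → c < k → A (c + k * r) < n
  row_inj : ∀ r c c', r < m → c < k → c' < k → A (c + k * r) = A (c' + k * r) → c = c'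
  le : k ≤ n
  word : (m + n) * (m + n) + 3 * (m + n) + 10 < W

/-- The elements among the first `min m k` positions of the rows. -/
def elts (m k : ℕ) (A : ℕ → ℕ) : Finset ℕ :=
  (Finset.range m ×ˢ Finset.range (min m k)).image fun p => A (p.2 + k * p.1)

theorem mem_elts {m k : ℕ} {A : ℕ → ℕ} {e : ℕ} :
    e ∈ elts m k A ↔ ∃ r < m, ∃ c < min m k, A (c + k * r) = e := by
  simp only [elts, Finset.mem_image, Finset.mem_product, Finset.mem_range, Prod.exists]
  constructor
  · rintro ⟨r, c, ⟨h1, h2⟩, h3⟩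
    exact ⟨r, h1, c, h2, h3⟩
  · rintro ⟨r, h1, c, h2, h3⟩
    exact ⟨r, c, ⟨h1, h2⟩, h3⟩

/-- The registers and the array that describe the input. -/
structure Ctx (m k : ℕ) (A : ℕ → ℕ) (s : State) : Prop where
  m_eq : s.reg 0 = m
  k_eq : s.reg 1 = k
  min_eq : s.reg 5 = min m k
  arr_eq : s.arr 0 = A

section

variable {W m k n : ℕ} {A : ℕ → ℕ} {p : Prog} {s s' : State}

/-- For a concrete program the side conditions are decidable, so they are default arguments proved
by `decide`. -/
theorem Ctx.frame (h : Ctx m k A s) (hf : Frame p s s') (h0 : 0 ∉ p.wregs := by decide)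
    (h1 : 1 ∉ p.wregs := by decide) (h5 : 5 ∉ p.wregs := by decide)
    (ha : 0 ∉ p.warrs := by decide) : Ctx m k A s' :=
  ⟨(hf.reg _ h0).trans h.m_eq, (hf.reg _ h1).trans h.k_eq, (hf.reg _ h5).trans h.min_eq,
    (hf.arr _ ha).trans h.arr_eq⟩

theorem Ctx.setReg (h : Ctx m k A s) {i v : ℕ} (h0 : i ≠ 0 := by decide)
    (h1 : i ≠ 1 := by decide) (h5 : i ≠ 5 := by decide) : Ctx m k A (s.setReg i v) := by
  refine ⟨?_, ?_, ?_, h.arr_eq⟩ <;> simp [h0.symm, h1.symm, h5.symm, h.m_eq, h.k_eq, h.min_eq]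

theorem Ctx.setArr (h : Ctx m k A s) {a i v : ℕ} (h0 : a ≠ 0 := by decide) :
    Ctx m k A (s.setArr a i v) :=
  ⟨h.m_eq, h.k_eq, h.min_eq, by simp [h0.symm, h.arr_eq]⟩

namespace Setup

theorem lt_word (S : Setup W m k n A) {a : ℕ} (h : a ≤ 3 * (m + n) + 10) : a < W := by
  have := S.word
  have h1 : 0 ≤ (m + n) * (m + n) := Nat.zero_le _
  omega

theorem mul_lt_word (S : Setup W m k n A) {a b : ℕ} (h : a ≤ m + n) (h' : b ≤ m + n) : a * b < W := by
  have := S.word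
  have h1 := Nat.mul_le_mul h h'
  omega

theorem idx_lt (S : Setup W m k n A) {r c : ℕ} (hr : r < m) (hc : c < k) : k * r < W ∧ c + k * r < W := by
  have h1 := S.le
  have h2 : k * (r + 1) < W := S.mul_lt_word (by omega) (by omega)
  rw [Nat.mul_succ] at h2
  omega

theorem elt_lt (S : Setup W m k n A) {e : ℕ} (h : e ∈ elts m k A) : e < n := by
  obtain ⟨r, hr, c, hc, rfl⟩ := mem_elts.1 h
  exact S.entry_lt r c hr (by omega)

end Setup

/-- The entry in the row and the column given by two registers. -/
def entryE (r c : ℕ) : Expr := .load 0 (.bin .add (.reg c) (.bin .mul (.reg 1) (.reg r)))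

@[simp] theorem entryE_cost {r c : ℕ} : (entryE r c).cost = 6 := rfl

theorem Ctx.entryE_eval (h : Ctx m k A s) {r c : ℕ} :
    (entryE r c).eval s = A (s.reg c + k * s.reg r) := by
  simp [entryE, h.arr_eq, h.k_eq]

theorem Ctx.entryE_fits (h : Ctx m k A s) (S : Setup W m k n A) {r c : ℕ} (hr : s.reg r < m)
    (hc : s.reg c < min m k) : (entryE r c).Fits W s := by
  have h1 := S.idx_lt hr (show s.reg c < k by omega)
  have h2 := S.entry_lt _ _ hr (show s.reg c < k by omega)
  have h3 := S.le
  have h4 : A (s.reg c + k * s.reg r) < W := S.lt_word (by omega)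
  have h5 : s.reg r < W := S.lt_word (by omega)
  have h6 : s.reg c < W := S.lt_word (by omega)
  have h7 : k < W := S.lt_word (by omega)
  simp [entryE, h.arr_eq, h.k_eq, *]

/-- Set the cells of all elements in the first positions to zero. -/
def clear (a : ℕ) : Prog := forLoop 7 0 (forLoop 8 5 (.store a (entryE 7 8) (.const 0)))

/-- Only cells of elements occurring in the first columns are reset, which keeps the cost
independent of `n`. A reset is needed because the decision procedure is run many times on the same
memory. -/
theorem wp_clear (S : Setup W m k n A) (h : Ctx m k A s) {a : ℕ} (ha : a ≠ 0) :
    wp W (clear a) s fun s' t => (∀ e ∈ elts m k A, s'.arr a e = 0) ∧ t ≤ 36 * (m * m) := by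
  have hm := S.pos
  have hW : m + 1 < W := S.lt_word (by omega)
  refine wp.mono (wp_forLoop_uniform (N := m) (T := m * 16 + 6)
    (fun i s => Ctx m k A s ∧ ∀ r < i, ∀ c < min m k, s.arr a (A (c + k * r)) = 0)
    (by decide) (by simp [Prog.wregs, forLoop, incr]) (by simp [Prog.wregs, forLoop, incr])
    h.m_eq hW ⟨h.setReg, by simp⟩ ?_) ?_
  · rintro i s hi h7 - ⟨hc, hz⟩
    refine wp.mono (wp_forLoop_uniform (N := min m k) (T := 8)
      (fun j s => Ctx m k A s ∧ s.reg 7 = i ∧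
        (∀ r < i, ∀ c < min m k, s.arr a (A (c + k * r)) = 0) ∧
        ∀ c < j, s.arr a (A (c + k * i)) = 0)
      (by decide) (by simp [Prog.wregs]) (by simp [Prog.wregs]) hc.min_eq (by omega)
      ⟨hc.setReg, by simpa using h7, by simpa using hz, by simp⟩ ?_) ?_
    · rintro j s hj h8 - ⟨hc, h7, hz, hz'⟩
      rw [wp_store]
      refine ⟨hc.entryE_fits S (by omega) (by omega), by simp; omega,
        ⟨(hc.setArr ha).setReg, by simpa using h7, ?_, ?_⟩, by simp⟩
      · intro r hr c hcc
        simp only [State.setReg_arr, State.setArr_arr, if_true, Function.update_apply]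
        split_ifs
        · rfl
        · exact hz r hr c hcc
      · intro c hcc
        simp only [State.setReg_arr, State.setArr_arr, if_true, Function.update_apply]
        split_ifs with he
        · rfl
        · rw [hc.entryE_eval, h7, h8] at he
          exact hz' c (by
            rcases Nat.lt_succ_iff_lt_or_eq.1 hcc with h | rfl
            · exact h
            · exact absurd rfl he)
    · rintro s' t ⟨⟨hc, h7, hz, hz'⟩, ht⟩
      refine ⟨⟨hc.setReg, ?_⟩, ht.trans ?_⟩
      · intro r hr c hcc
        rcases Nat.lt_succ_iff_lt_or_eq.1 hr with h | rfl
        · exact hz r h c hcc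
        · exact hz' c hcc
      · have := Nat.mul_le_mul_right 16 (min_le_left m k)
        omega
  · rintro s' t ⟨⟨hc, hz⟩, ht⟩
    refine ⟨fun e he => ?_, ht.trans (by nlinarith)⟩
    obtain ⟨r, hr, c, hcc, rfl⟩ := mem_elts.1 he
    exact hz r hr c hcc

/-- `d` is `1` plus the position of `x` among the first `min m k` positions of row `r`, or `0` if
`x` is not there. -/
def IsDist (m k : ℕ) (A : ℕ → ℕ) (x r d : ℕ) : Prop :=
  (d = 0 ∧ ∀ c < min m k, A (c + k * r) ≠ x) ∨ ∃ c < min m k, A (c + k * r) = x ∧ d = c + 1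

theorem IsDist.le {x r d : ℕ} (h : IsDist m k A x r d) : d ≤ min m k := by
  rcases h with h | h
  · omega
  · obtain ⟨c, h1, -, h2⟩ := h
    omega

/-- Compute the positions of `x`. -/
def distances : Prog :=
  forLoop 7 0 (.comp (.store 2 (.reg 7) (.const 0)) (forLoop 8 5
    (.cond (.bin .eq (entryE 7 8) (.reg 3)) (.store 2 (.reg 7) (.bin .add (.reg 8) (.const 1)))
      .skip)))

theorem wp_distances (S : Setup W m k n A) (h : Ctx m k A s) {x : ℕ} (hx : s.reg 3 = x)
    (hxn : x < n) :
    wp W distances s fun s' t =>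
      (∀ r < m, IsDist m k A x r (s'.arr 2 r)) ∧ t ≤ 60 * (m * m) := by
  have hm := S.pos
  have hW : m + 1 < W := S.lt_word (by omega)
  have hxW : x < W := S.lt_word (by omega)
  refine wp.mono (wp_forLoop_uniform (N := m) (T := m * 22 + 9)
    (fun i s => Ctx m k A s ∧ s.reg 3 = x ∧ ∀ r < i, IsDist m k A x r (s.arr 2 r))
    (by decide) (by decide) (by decide)
    h.m_eq hW ⟨h.setReg, by simpa using hx, by simp⟩ ?_) ?_
  · rintro i s hi h7 - ⟨hc, h3, hz⟩
    rw [wp_comp, wp_store]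
    refine ⟨by simp; omega, by simp; omega, ?_⟩
    refine wp.mono (wp_forLoop_uniform (N := min m k) (T := 14)
      (fun j s => Ctx m k A s ∧ s.reg 3 = x ∧ s.reg 7 = i ∧
        (∀ r < i, IsDist m k A x r (s.arr 2 r)) ∧
        ((s.arr 2 i = 0 ∧ ∀ c < j, A (c + k * i) ≠ x) ∨
          ∃ c < min m k, A (c + k * i) = x ∧ s.arr 2 i = c + 1))
      (by decide) (by decide) (by decide) hc.min_eq (by omega)
      ⟨hc.setArr.setReg, by simpa using h3, by simpa using h7, ?_, ?_⟩ ?_) ?_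
    · intro r hr
      have : r ≠ s.reg 7 := by omega
      simpa [this] using hz r hr
    · simp [h7]
    · rintro j s hj h8 - ⟨hc, h3, h7, hz, hz'⟩
      rw [wp_cond]
      have hfit := hc.entryE_fits S (r := 7) (c := 8) (by omega) (by omega)
      have hev := hc.entryE_eval (r := 7) (c := 8)
      rw [h7, h8] at hev
      refine ⟨⟨hfit, by simp; omega, ?_⟩, fun he => ?_, fun he => ?_⟩
      · simp only [Op.apply]
        split_ifs <;> omega
      · have he' : A (j + k * i) = x := by
          by_contra hne
          simp [hev, h3, hne] at he
        rw [wp_store]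
        refine ⟨by clear hz'; simp; omega, by clear hz'; simp; omega, ⟨hc.setArr.setReg, by simpa using h3,
          by simpa using h7, ?_, Or.inr ⟨j, hj, he', by simp [h7, h8]⟩⟩, by simp⟩
        intro r hr
        have : r ≠ s.reg 7 := by omega
        simpa [this] using hz r hr
      · have he' : A (j + k * i) ≠ x := by
          intro hne
          simp [hev, h3, hne] at he
        rw [wp_skip]
        refine ⟨⟨hc.setReg, by simpa using h3, by simpa using h7, hz, ?_⟩, by simp⟩
        rcases hz' with ⟨h1, h2⟩ | h1
        · refine Or.inl ⟨h1, fun c hcc => ?_⟩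
          rcases Nat.lt_succ_iff_lt_or_eq.1 hcc with h | rfl
          · exact h2 c h
          · exact he'
        · exact Or.inr h1
    · rintro s' t ⟨⟨hc, h3, h7, hz, hz'⟩, ht⟩
      refine ⟨⟨hc.setReg, by simpa using h3, ?_⟩, ?_⟩
      · intro r hr
        rcases Nat.lt_succ_iff_lt_or_eq.1 hr with h | rfl
        · exact hz r h
        · exact hz'
      · have := Nat.mul_le_mul_right 22 (min_le_left m k)
        simp
        omega
  · rintro s' t ⟨⟨hc, h3, hz⟩, ht⟩
    exact ⟨hz, ht.trans (by nlinarith)⟩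

/-- `L` is the square root of `m`, rounded up. -/
structure IsRoot (m L : ℕ) : Prop where
  pos : 0 < L
  le : L ≤ m
  le_sq : m ≤ L * L
  sq_lt : (L - 1) * (L - 1) < m

/-- Compute `min m k` and the square root of `m`. -/
def prepare : Prog :=
  .comp (.cond (.bin .lt (.reg 0) (.reg 1)) (.assign 5 (.reg 0)) (.assign 5 (.reg 1)))
    (.comp (.assign 6 (.const 0))
      (.loop (.bin .lt (.bin .mul (.reg 6) (.reg 6)) (.reg 0)) (incr 6)))

theorem wp_prepare (S : Setup W m k n A) (h0 : s.reg 0 = m) (h1 : s.reg 1 = k)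
    (hA : s.arr 0 = A) :
    wp W prepare s fun s' t => Ctx m k A s' ∧ IsRoot m (s'.reg 6) ∧ t ≤ 30 * m := by
  have hm := S.pos
  have hk := S.le
  have hW : m + n + 1 < W := S.lt_word (by omega)
  have key : ∀ s : State, Ctx m k A s → wp W (.loop (.bin .lt (.bin .mul (.reg 6) (.reg 6))
      (.reg 0)) (incr 6)) (s.setReg 6 0) fun s' t => Ctx m k A s' ∧ IsRoot m (s'.reg 6) ∧
        t ≤ 10 * m + 6 := by
    intro s hc
    refine wp.mono (wp_loop (fun s t => Ctx m k A s ∧ s.reg 6 ≤ m ∧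
      (s.reg 6 = 0 ∨ (s.reg 6 - 1) * (s.reg 6 - 1) < m) ∧ t ≤ 10 * s.reg 6)
      (fun s => m - s.reg 6) ⟨hc.setReg, by simp, by simp, by simp⟩ ?_ ?_) ?_
    · rintro s t ⟨hc, h1, h2, h3⟩
      have := S.mul_lt_word (a := s.reg 6) (b := s.reg 6) (by omega) (by omega)
      refine ⟨⟨by simp; omega, by simp; omega, by simpa using this⟩, by simp [hc.m_eq]; omega, ?_⟩
      simp only [Op.apply]
      split_ifs <;> omega
    · rintro s t ⟨hc, h1, h2, h3⟩ he
      have hlt : s.reg 6 * s.reg 6 < m := by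
        by_contra hn
        simp [hc.m_eq, hn] at he
      -- A number is at most its square, so the counter is still below `m` and the linear search for
      -- the root takes at most `m` rounds.
      have := Nat.le_mul_self (s.reg 6)
      rw [wp_incr]
      refine ⟨by omega, ⟨hc.setReg, by simp; omega, by simpa using hlt, ?_⟩, ?_⟩
      · simp; omega
      · simp; omega
    · rintro s' t ⟨t₀, rfl, ⟨hc, h1, h2, h3⟩, he⟩
      have hle : m ≤ s'.reg 6 * s'.reg 6 := by
        by_contra hn
        simp [hc.m_eq, hn] at he
      have hpos : 0 < s'.reg 6 := by
        rcases Nat.eq_zero_or_pos (s'.reg 6) with h | h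
        · rw [h] at hle
          omega
        · exact h
      exact ⟨hc, ⟨hpos, h1, hle, h2.resolve_left hpos.ne'⟩, by simp; omega⟩
  simp only [prepare, wp_comp, wp_cond, wp_assign]
  refine ⟨⟨by simp; omega, by simp; omega, ?_⟩, fun he => ⟨by simp; omega, ?_⟩,
    fun he => ⟨by simp; omega, ?_⟩⟩
  · simp only [Op.apply]
    split_ifs <;> omega
  all_goals
    refine ⟨by simp; omega, wp.mono (key _ ?_) ?_⟩
    · refine ⟨by simpa using h0, by simpa using h1, ?_, by simpa using hA⟩
      simp [h0, h1] at he ⊢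
      omega
    · rintro s' t ⟨h1, h2, h3⟩
      exact ⟨h1, h2, by simp; omega⟩

end

/-! ### The auction

Rows bid for the cheapest element that they prefer to `x`; each sale raises the price of the
element by one, and the previous holder becomes the next bidder. -/

section

variable {m k : ℕ} {A D H P U : ℕ → ℕ} {L rp hand cnt : ℕ}

/-- The elements that row `r` prefers to `x`, where `D r` is `1` plus the position of `x`. -/
def nbrs (k : ℕ) (A D : ℕ → ℕ) (r : ℕ) : Finset ℕ :=
  (Finset.range (D r - 1)).image fun c => A (c + k * r)

theorem mem_nbrs {r e : ℕ} : e ∈ nbrs k A D r ↔ ∃ c, c + 1 < D r ∧ A (c + k * r) = e := by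
  simp only [nbrs, Finset.mem_image, Finset.mem_range, Nat.lt_sub_iff_add_lt]

theorem nbrs_subset {r : ℕ} (hr : r < m) (hD : D r ≤ min m k) : nbrs k A D r ⊆ elts m k A := by
  intro e he
  obtain ⟨c, hc, rfl⟩ := mem_nbrs.1 he
  exact mem_elts.2 ⟨r, hr, c, by omega, rfl⟩

/-- All rows `r` with `D r ≠ 0` can be matched. -/
def Sat (m k : ℕ) (A D : ℕ → ℕ) : Prop :=
  ∃ σ : ℕ → ℕ, (∀ r < m, D r ≠ 0 → σ r ∈ nbrs k A D r) ∧
    ∀ r < m, ∀ r' < m, D r ≠ 0 → D r' ≠ 0 → σ r = σ r' → r = r'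

/-- `H` is a matching: `H e` is `1` plus the row that holds `e`, or `0` if `e` is free. -/
structure IsPartial (m k : ℕ) (A D H : ℕ → ℕ) : Prop where
  mem : ∀ e ∈ elts m k A, ∀ r, H e = r + 1 → r < m ∧ e ∈ nbrs k A D r
  inj : ∀ e ∈ elts m k A, ∀ e' ∈ elts m k A, H e = H e' → H e ≠ 0 → e = e'

/-- Row `r` holds an element. -/
def Held (m k : ℕ) (A H : ℕ → ℕ) (r : ℕ) : Prop := ∃ e ∈ elts m k A, H e = r + 1

theorem IsPartial.le (h : IsPartial m k A D H) {e : ℕ} (he : e ∈ elts m k A) : H e ≤ m := by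
  rcases Nat.eq_zero_or_pos (H e) with h0 | h0
  · omega
  · have := (h.mem e he (H e - 1) (by omega)).1
    omega

/-- The map from held elements to their holders is injective. -/
theorem IsPartial.card_le (h : IsPartial m k A D H) :
    ((elts m k A).filter fun e => H e ≠ 0).card ≤ m := by
  have := Finset.card_le_card_of_injOn (s := (elts m k A).filter fun e => H e ≠ 0)
    (t := Finset.range m) (fun e => H e - 1) ?_ ?_
  · simpa using this
  · intro e he
    simp only [Finset.coe_filter, Set.mem_ofPred_eq] at he
    have := h.le he.1
    simp only [Finset.coe_range, Set.mem_Iio]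
    omega
  · intro e he e' he' heq
    simp only [Finset.coe_filter, Set.mem_ofPred_eq] at he he' heq
    exact h.inj e he.1 e' he'.1 (by omega) he.2

/-- The rows are matched if all rows with `D r ≠ 0` hold an element. -/
theorem IsPartial.sat (h : IsPartial m k A D H)
    (hall : ∀ r < m, D r ≠ 0 → Held m k A H r) : Sat m k A D := by
  have : ∀ r, ∃ e, r < m → D r ≠ 0 → e ∈ elts m k A ∧ H e = r + 1 := by
    intro r
    by_cases hr : r < m ∧ D r ≠ 0
    · obtain ⟨e, he, he'⟩ := hall r hr.1 hr.2
      exact ⟨e, fun _ _ => ⟨he, he'⟩⟩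
    · exact ⟨0, fun h1 h2 => absurd ⟨h1, h2⟩ hr⟩
  choose σ hσ using this
  refine ⟨σ, fun r hr hd => ?_, fun r hr r' hr' hd hd' he => ?_⟩
  · obtain ⟨h1, h2⟩ := hσ r hr hd
    exact (h.mem _ h1 r h2).2
  · obtain ⟨-, h2⟩ := hσ r hr hd
    obtain ⟨-, h3⟩ := hσ r' hr' hd'
    rw [he] at h2
    omega

/-- The invariant of the auction: `P` are the prices, rows `r < rp` have been called, the row
`hand - 1` is bidding if `hand ≠ 0`, and `U` lists the `cnt` rows that gave up. -/
structure Auction (m k : ℕ) (A D : ℕ → ℕ) (L : ℕ) (H P U : ℕ → ℕ) (rp hand cnt : ℕ) : Prop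
    extends IsPartial m k A D H where
  rp_le : rp ≤ m
  lt_rp : ∀ e ∈ elts m k A, ∀ r, H e = r + 1 → r < rp
  price_free : ∀ e ∈ elts m k A, H e = 0 → P e = 0
  price_le : ∀ e ∈ elts m k A, P e ≤ L
  slack : ∀ e ∈ elts m k A, ∀ r, H e = r + 1 → ∀ e' ∈ nbrs k A D r, P e ≤ P e' + 1
  hand_ok : ∀ r, hand = r + 1 → r < rp ∧ D r ≠ 0 ∧ ¬ Held m k A H r ∧ ∀ i < cnt, U i ≠ r
  gave_up : ∀ i < cnt, U i < rp ∧ D (U i) ≠ 0 ∧ ¬ Held m k A H (U i) ∧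
    ∀ e ∈ nbrs k A D (U i), L ≤ P e
  gave_up_inj : ∀ i < cnt, ∀ j < cnt, U i = U j → i = j
  cover : ∀ r < rp, D r ≠ 0 → Held m k A H r ∨ hand = r + 1 ∨ ∃ i < cnt, U i = r

namespace Auction

theorem init (hH : ∀ e ∈ elts m k A, H e = 0) (hP : ∀ e ∈ elts m k A, P e = 0) :
    Auction m k A D L H P U 0 0 0 where
  mem e he r h := by simp [hH e he] at h
  inj e he _ _ _ h := absurd (hH e he) h
  rp_le := Nat.zero_le _
  lt_rp e he r h := by simp [hH e he] at h
  price_free e he _ := hP e he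
  price_le e he := by simp [hP e he]
  slack e he r h := by simp [hH e he] at h
  hand_ok r h := by simp at h
  gave_up i h := by simp at h
  gave_up_inj i h := by simp at h
  cover r h := by simp at h

theorem call (h : Auction m k A D L H P U rp 0 cnt) (hrp : rp < m) (hd : D rp ≠ 0) :
    Auction m k A D L H P U (rp + 1) (rp + 1) cnt where
  toIsPartial := h.toIsPartial
  rp_le := hrp
  lt_rp e he r hr := (h.lt_rp e he r hr).trans (Nat.lt_succ_self _)
  price_free := h.price_free
  price_le := h.price_le
  slack := h.slack
  hand_ok r hr := by
    obtain rfl : rp = r := by omega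
    refine ⟨Nat.lt_succ_self _, hd, ?_, fun i hi => (h.gave_up i hi).1.ne⟩
    rintro ⟨e, he, he'⟩
    exact lt_irrefl _ (h.lt_rp e he _ he')
  gave_up i hi := ⟨(h.gave_up i hi).1.trans (Nat.lt_succ_self _), (h.gave_up i hi).2⟩
  gave_up_inj := h.gave_up_inj
  cover r hr hd := by
    rcases Nat.lt_succ_iff_lt_or_eq.1 hr with hlt | rfl
    · rcases h.cover r hlt hd with h1 | h1 | h1
      · exact Or.inl h1
      · omega
      · exact Or.inr (Or.inr h1)
    · exact Or.inr (Or.inl rfl)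

theorem skip (h : Auction m k A D L H P U rp 0 cnt) (hrp : rp < m) (hd : D rp = 0) :
    Auction m k A D L H P U (rp + 1) 0 cnt where
  toIsPartial := h.toIsPartial
  rp_le := hrp
  lt_rp e he r hr := (h.lt_rp e he r hr).trans (Nat.lt_succ_self _)
  price_free := h.price_free
  price_le := h.price_le
  slack := h.slack
  hand_ok r hr := by omega
  gave_up i hi := ⟨(h.gave_up i hi).1.trans (Nat.lt_succ_self _), (h.gave_up i hi).2⟩
  gave_up_inj := h.gave_up_inj
  cover r hr hd' := by
    rcases Nat.lt_succ_iff_lt_or_eq.1 hr with hlt | rfl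
    · exact h.cover r hlt hd'
    · exact absurd hd hd'

/-- The new holder satisfies `slack` because it bought at the minimum and pays one more; for other
holders the inequality survives because prices of neighbours only rise. The next value of `hand` is
`H b` itself: both use the code "row plus one, or zero", so the evicted row bids next, and nobody
does if `b` was free. -/
theorem bid {r b : ℕ} (h : Auction m k A D L H P U rp (r + 1) cnt) (hD : D r ≤ min m k)
    (hb : b ∈ nbrs k A D r) (hbL : P b < L) (hmin : ∀ e ∈ nbrs k A D r, P b ≤ P e) :
    Auction m k A D L (Function.update H b (r + 1)) (Function.update P b (P b + 1)) U rp (H b)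
      cnt := by
  obtain ⟨hr, hd, hheld, hU⟩ := h.hand_ok r rfl
  have hrm : r < m := hr.trans_le h.rp_le
  have hbE : b ∈ elts m k A := nbrs_subset hrm hD hb
  have hne : ∀ e ∈ elts m k A, H e ≠ r + 1 := fun e he he' => hheld ⟨e, he, he'⟩
  have hup : ∀ e, P e ≤ Function.update P b (P b + 1) e := fun e => by
    rw [Function.update_apply]
    split_ifs with h1
    · rw [h1]
      omega
    · exact le_rfl
  have hheld' : ∀ r', Held m k A (Function.update H b (r + 1)) r' →
      r' = r ∨ (Held m k A H r' ∧ H b ≠ r' + 1) := by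
    rintro r' ⟨e, he, he'⟩
    rw [Function.update_apply] at he'
    split_ifs at he' with h1
    · exact Or.inl (by omega)
    · refine Or.inr ⟨⟨e, he, he'⟩, fun h2 => h1 ?_⟩
      exact h.inj e he b hbE (he'.trans h2.symm) (by omega)
  constructor
  · constructor
    · intro e he r' h'
      rw [Function.update_apply] at h'
      split_ifs at h' with h1
      · obtain rfl : r = r' := by omega
        exact ⟨hrm, h1 ▸ hb⟩
      · exact h.mem e he r' h'
    · intro e he e' he' heq h0
      rw [Function.update_apply] at heq h0
      rw [Function.update_apply] at heq
      split_ifs at heq h0 with h1 h2 h2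
      · rw [h1, h2]
      · exact absurd heq.symm (hne e' he')
      · exact absurd heq (hne e he)
      · exact h.inj e he e' he' heq h0
  · exact h.rp_le
  · intro e he r' h'
    rw [Function.update_apply] at h'
    split_ifs at h' with h1
    · omega
    · exact h.lt_rp e he r' h'
  · intro e he h'
    rw [Function.update_apply] at h' ⊢
    split_ifs at h' ⊢ with h1
    exact h.price_free e he h'
  · intro e he
    rw [Function.update_apply]
    split_ifs with h1
    · omega
    · exact h.price_le e he
  · intro e he r' h' e' he'
    rw [Function.update_apply] at h'
    split_ifs at h' with h1
    · obtain rfl : r = r' := by omega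
      rw [h1, Function.update_self]
      exact Nat.succ_le_succ ((hmin e' he').trans (hup e'))
    · rw [Function.update_of_ne h1]
      exact (h.slack e he r' h' e' he').trans (Nat.succ_le_succ (hup e'))
  · intro r' hr'
    have hheldr' : Held m k A H r' := ⟨b, hbE, hr'⟩
    have hm' := h.mem b hbE r' hr'
    refine ⟨h.lt_rp b hbE r' hr', ?_, ?_, ?_⟩
    · obtain ⟨c, hc, -⟩ := mem_nbrs.1 hm'.2
      omega
    · intro h1
      rcases hheld' r' h1 with rfl | h2
      · exact hheld hheldr'
      · exact h2.2 hr'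
    · rintro i hi rfl
      exact (h.gave_up i hi).2.2.1 hheldr'
  · intro i hi
    obtain ⟨h1, h2, h3, h4⟩ := h.gave_up i hi
    refine ⟨h1, h2, fun h5 => ?_, fun e he => (h4 e he).trans (hup e)⟩
    rcases hheld' _ h5 with h6 | h6
    · exact hU i hi h6
    · exact h3 h6.1
  · exact h.gave_up_inj
  · intro r' hr' hd'
    by_cases h0 : r' = r
    · exact Or.inl ⟨b, hbE, by simp [h0]⟩
    rcases h.cover r' hr' hd' with ⟨e, he, he'⟩ | h1 | h1
    · by_cases h1 : e = b
      · exact Or.inr (Or.inl (h1 ▸ he'))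
      · exact Or.inl ⟨e, he, by rw [Function.update_of_ne h1, he']⟩
    · omega
    · exact Or.inr (Or.inr h1)

theorem give_up {r : ℕ} (h : Auction m k A D L H P U rp (r + 1) cnt)
    (hL : ∀ e ∈ nbrs k A D r, L ≤ P e) :
    Auction m k A D L H P (Function.update U cnt r) rp 0 (cnt + 1) := by
  obtain ⟨hr, hd, hheld, hU⟩ := h.hand_ok r rfl
  have hold : ∀ i < cnt, Function.update U cnt r i = U i := fun i hi =>
    Function.update_of_ne hi.ne _ _
  refine ⟨h.toIsPartial, h.rp_le, h.lt_rp, h.price_free, h.price_le, h.slack, ?_, ?_, ?_, ?_⟩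
  · intro r' h'
    omega
  · intro i hi
    rcases Nat.lt_succ_iff_lt_or_eq.1 hi with h1 | rfl
    · rw [hold i h1]
      exact h.gave_up i h1
    · rw [Function.update_self]
      exact ⟨hr, hd, hheld, hL⟩
  · intro i hi j hj hij
    rcases Nat.lt_succ_iff_lt_or_eq.1 hi with h1 | rfl <;>
      rcases Nat.lt_succ_iff_lt_or_eq.1 hj with h2 | rfl
    · rw [hold i h1, hold j h2] at hij
      exact h.gave_up_inj i h1 j h2 hij
    · rw [hold i h1, Function.update_self] at hij
      exact absurd hij (hU i h1)
    · rw [hold j h2, Function.update_self] at hij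
      exact absurd hij.symm (hU j h2)
    · rfl
  · intro r' hr' hd'
    rcases h.cover r' hr' hd' with h1 | h1 | ⟨i, hi, h1⟩
    · exact Or.inl h1
    · exact Or.inr (Or.inr ⟨cnt, Nat.lt_succ_self _, by rw [Function.update_self]; omega⟩)
    · exact Or.inr (Or.inr ⟨i, by omega, by rw [hold i hi, h1]⟩)

theorem cnt_le (h : Auction m k A D L H P U rp hand cnt) : cnt ≤ m := by
  have := Finset.card_le_card_of_injOn (s := Finset.range cnt) (t := Finset.range m) U ?_ ?_
  · simpa using this
  · intro i hi
    simp only [Finset.coe_range, Set.mem_Iio] at hi ⊢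
    exact (h.gave_up i hi).1.trans_le h.rp_le
  · intro i hi j hj
    simp only [Finset.coe_range, Set.mem_Iio] at hi hj
    exact h.gave_up_inj i hi j hj

/-- Free elements have price zero, and at most `m` elements are held, each at a price of at most
`L`. As every bid raises the sum by one, this bounds the number of bids. -/
theorem sum_price_le (h : Auction m k A D L H P U rp hand cnt) :
    ∑ e ∈ elts m k A, P e ≤ m * L := by
  calc ∑ e ∈ elts m k A, P e = ∑ e ∈ (elts m k A).filter fun e => H e ≠ 0, P e :=
        (Finset.sum_filter_of_ne (p := fun e => H e ≠ 0)
          fun e he hp h0 => hp (h.price_free e he h0)).symm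
    _ ≤ ((elts m k A).filter fun e => H e ≠ 0).card * L :=
        Finset.sum_le_card_nsmul _ _ _ fun e he => h.price_le e (Finset.mem_filter.1 he).1
    _ ≤ m * L := Nat.mul_le_mul_right _ h.card_le

/-- If all rows can be matched, then few rows give up. -/
theorem cnt_mul_le (h : Auction m k A D L H P U m 0 cnt) (hD : ∀ r < m, D r ≤ min m k)
    (hs : Sat m k A D) : cnt * L ≤ m := by
  classical
  obtain ⟨σ, hσ, hσi⟩ := hs
  -- `T j` is the level set of elements of price at least `j`. For positive `j` all its elements are
  -- held, because free elements cost nothing.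
  let T : ℕ → Finset ℕ := fun j => (elts m k A).filter fun e => j ≤ P e
  have hT : ∀ j, ∀ e ∈ T (j + 1), H e ≠ 0 := fun j e he h0 => by
    have := (Finset.mem_filter.1 he)
    have := h.price_free e this.1 h0
    omega
  have key : ∀ j, 1 ≤ j → j ≤ L → cnt + (T (j + 1)).card ≤ (T j).card := by
    intro j hj hjL
    have hU : ((Finset.range cnt).image U).card = cnt := by
      rw [Finset.card_image_of_injOn, Finset.card_range]
      intro i hi j hj
      simp only [Finset.coe_range, Set.mem_Iio] at hi hj
      exact h.gave_up_inj i hi j hj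
    have hV : ((T (j + 1)).image fun e => H e - 1).card = (T (j + 1)).card := by
      refine Finset.card_image_of_injOn fun e he e' he' heq => ?_
      have h1 := hT j e he
      have h2 := hT j e' he'
      have heq : H e - 1 = H e' - 1 := heq
      exact h.inj e (Finset.mem_filter.1 he).1 e' (Finset.mem_filter.1 he').1 (by omega) h1
    have hdis : Disjoint ((Finset.range cnt).image U) ((T (j + 1)).image fun e => H e - 1) := by
      rw [Finset.disjoint_left]
      intro r hr hr'
      obtain ⟨i, hi, rfl⟩ := Finset.mem_image.1 hr
      obtain ⟨e, he, he'⟩ := Finset.mem_image.1 hr'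
      have h1 := hT j e he
      exact (h.gave_up i (Finset.mem_range.1 hi)).2.2.1
        ⟨e, (Finset.mem_filter.1 he).1, by omega⟩
    rw [← hU, ← hV, ← Finset.card_union_of_disjoint hdis]
    -- All neighbours of these rows lie in `T j`: for holders in `T (j + 1)` by `slack`, for rows
    -- that gave up because their neighbours cost at least `L ≥ j`. Hence `σ` maps these `cnt + |T
    -- (j + 1)|` distinct rows injectively into `T j`.
    have hact : ∀ r ∈ (Finset.range cnt).image U ∪ (T (j + 1)).image (fun e => H e - 1),
        r < m ∧ D r ≠ 0 ∧ ∀ e ∈ nbrs k A D r, j ≤ P e := by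
      intro r hr
      rcases Finset.mem_union.1 hr with hr | hr
      · obtain ⟨i, hi, rfl⟩ := Finset.mem_image.1 hr
        obtain ⟨h1, h2, -, h4⟩ := h.gave_up i (Finset.mem_range.1 hi)
        exact ⟨h1, h2, fun e he => hjL.trans (h4 e he)⟩
      · obtain ⟨e, he, rfl⟩ := Finset.mem_image.1 hr
        have h1 := hT j e he
        have h2 := Finset.mem_filter.1 he
        have h3 := h.mem e h2.1 (H e - 1) (by omega)
        refine ⟨h3.1, ?_, fun e' he' => ?_⟩
        · obtain ⟨c, hc, -⟩ := mem_nbrs.1 h3.2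
          omega
        · have := h.slack e h2.1 (H e - 1) (by omega) e' he'
          omega
    refine Finset.card_le_card_of_injOn σ (fun r hr => ?_) fun r hr r' hr' heq => ?_
    · obtain ⟨h1, h2, h3⟩ := hact r hr
      have h4 := hσ r h1 h2
      exact Finset.mem_filter.2 ⟨nbrs_subset h1 (hD r h1) h4, h3 _ h4⟩
    · obtain ⟨h1, h2, -⟩ := hact r hr
      obtain ⟨h1', h2', -⟩ := hact r' hr'
      exact hσi r h1 r' h1' h2 h2' heq
  -- Telescoping from level `L + 1` down to level `1`, with a gain of `cnt` per level; `T 1` has at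
  -- most `m` elements.
  have hind : ∀ i ≤ L, cnt * i ≤ (T (L + 1 - i)).card := by
    intro i
    induction i with
    | zero => simp
    | succ i ih =>
      intro hi
      have h1 := ih (by omega)
      have h2 := key (L + 1 - (i + 1)) (by omega) (by omega)
      rw [show L + 1 - (i + 1) + 1 = L + 1 - i by omega] at h2
      rw [Nat.mul_succ]
      omega
  have h1 := hind L le_rfl
  rw [show L + 1 - L = 0 + 1 by omega] at h1
  refine h1.trans ((Finset.card_le_card fun e he => ?_).trans h.card_le)
  exact Finset.mem_filter.2 ⟨(Finset.mem_filter.1 he).1, hT 0 e he⟩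

end Auction

end

/-! ### The auction on the machine: correctness and running time -/

section

variable {W m k n : ℕ} {A D : ℕ → ℕ} {L : ℕ} {s : State}

/-- Find a cheapest element among the first positions of the row in register `14`. -/
def scan : Prog :=
  forLoop 8 15 (.cond (.bin .lt (.load 4 (entryE 14 8)) (.reg 11))
    (.comp (.assign 12 (entryE 14 8)) (.assign 11 (.load 4 (.reg 12)))) .skip)

/-- Register `14` holds the row and register `15` the number of its entries before `x`. The running
minimum in register `11` starts at the cap `L`; register `12` is meaningful only if the minimum
drops below `L`, that is, if the row can afford a bid. -/
theorem wp_scan (S : Setup W m k n A) (h : Ctx m k A s) {r d : ℕ} (h14 : s.reg 14 = r)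
    (hr : r < m) (h15 : s.reg 15 = d) (hd : d ≤ min m k) (h11 : s.reg 11 = L) (hL : L ≤ m)
    (hP : ∀ e ∈ elts m k A, s.arr 4 e ≤ L) :
    wp W scan s fun s' t =>
      (s'.reg 11 ≤ L ∧ (∀ c < d, s'.reg 11 ≤ s.arr 4 (A (c + k * r))) ∧ (s'.reg 11 < L →
        ∃ c < d, s'.reg 12 = A (c + k * r) ∧ s.arr 4 (A (c + k * r)) = s'.reg 11)) ∧
      t ≤ d * 28 + 6 := by
  have hm := S.pos
  have hn := S.le
  have hW : m + n + 1 < W := S.lt_word (by omega)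
  refine wp.mono (wp_forLoop_uniform (N := d) (T := 20)
    (fun j s' => Ctx m k A s' ∧ s'.reg 14 = r ∧ s'.arr 4 = s.arr 4 ∧ s'.reg 11 ≤ L ∧
      (∀ c < j, s'.reg 11 ≤ s.arr 4 (A (c + k * r))) ∧ (s'.reg 11 < L →
        ∃ c < d, s'.reg 12 = A (c + k * r) ∧ s.arr 4 (A (c + k * r)) = s'.reg 11))
    (by decide) (by decide) (by decide) h15 (by omega)
    ⟨h.setReg, by simpa using h14, rfl, by simp [h11], by simp, by simp [h11]⟩ ?_) ?_
  · rintro j s' hj h8 - ⟨hc, h14, h4, h11, hle, hex⟩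
    have hE : A (j + k * r) ∈ elts m k A := mem_elts.2 ⟨r, hr, j, by omega, rfl⟩
    have hEP := hP _ hE
    have hEn := S.elt_lt hE
    have hfit := hc.entryE_fits S (r := 14) (c := 8) (by omega) (by omega)
    have hev := hc.entryE_eval (r := 14) (c := 8)
    rw [h14, h8] at hev
    rw [wp_cond]
    refine ⟨⟨⟨hfit, by rw [hev, h4]; omega⟩, by simp; omega, ?_⟩, fun he => ?_, fun he => ?_⟩
    · simp only [Op.apply]
      split_ifs <;> omega
    · have hlt : s.arr 4 (A (j + k * r)) < s'.reg 11 := by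
        by_contra hn
        simp [hev, h4, hn] at he
      simp only [wp_comp, wp_assign]
      refine ⟨hfit, by simp [hev, h4]; omega,
        ⟨hc.setReg.setReg.setReg, by simpa using h14, by simpa using h4, ?_, ?_, ?_⟩, by simp⟩
      · simp [hev, h4]
        omega
      · intro c hcj
        simp only [State.setReg_reg, State.setReg_arr, Expr.eval, hev, h4]
        rcases Nat.lt_succ_iff_lt_or_eq.1 hcj with h1 | rfl
        · simpa using hlt.le.trans (hle c h1)
        · simp
      · intro _
        exact ⟨j, hj, by simp [hev], by simp [hev, h4]⟩
    · have hlt : s'.reg 11 ≤ s.arr 4 (A (j + k * r)) := by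
        by_contra hn
        simp [hev, h4, not_le.1 hn] at he
      rw [wp_skip]
      refine ⟨⟨hc.setReg, by simpa using h14, by simpa using h4, by simpa using h11, ?_, ?_⟩,
        by simp⟩
      · intro c hcj
        rcases Nat.lt_succ_iff_lt_or_eq.1 hcj with h1 | rfl
        · simpa using hle c h1
        · simpa using hlt
      · simpa using hex
  · rintro s' t ⟨⟨-, -, -, h0, h1, h2⟩, ht⟩
    exact ⟨⟨h0, h1, h2⟩, by omega⟩

/-- The row `hand - 1` buys the element found, or gives up if it is too expensive. -/
def bid : Prog :=
  .cond (.bin .lt (.reg 11) (.reg 6))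
    (.comp (.store 4 (.reg 12) (.bin .add (.reg 11) (.const 1)))
      (.comp (.assign 16 (.load 3 (.reg 12)))
        (.comp (.store 3 (.reg 12) (.reg 9)) (.assign 9 (.reg 16)))))
    (.comp (.store 5 (.reg 10) (.reg 14)) (.comp (incr 10) (.assign 9 (.const 0))))

/-- One step of the auction: call the next row, or let the row `hand - 1` bid. -/
def auctionStep : Prog :=
  .cond (.bin .eq (.reg 9) (.const 0))
    (.comp (.cond (.load 2 (.reg 13)) (.assign 9 (.bin .add (.reg 13) (.const 1))) .skip)
      (incr 13))
    (.comp (.assign 14 (.bin .sub (.reg 9) (.const 1)))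
      (.comp (.assign 15 (.bin .sub (.load 2 (.reg 14)) (.const 1)))
        (.comp (.assign 11 (.reg 6)) (.comp scan bid))))

/-- The auction. -/
def auction : Prog :=
  .comp (clear 3) (.comp (clear 4) (.comp (.assign 9 (.const 0)) (.comp (.assign 10 (.const 0))
    (.comp (.assign 13 (.const 0))
      -- The sum serves as a disjunction: some row is bidding, or some row has not been called yet.
      (.loop (.bin .add (.reg 9) (.bin .lt (.reg 13) (.reg 0))) auctionStep)))))

/-- The invariant of the auction in a machine state. -/
structure AuctionState (m k : ℕ) (A D : ℕ → ℕ) (L : ℕ) (s : State) : Prop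
    extends Ctx m k A s where
  root_eq : s.reg 6 = L
  dist_eq : s.arr 2 = D
  auc : Auction m k A D L (s.arr 3) (s.arr 4) (s.arr 5) (s.reg 13) (s.reg 9) (s.reg 10)

/-- The potential of the auction: an upper bound for the number of remaining steps. -/
def potential (m k : ℕ) (A : ℕ → ℕ) (L : ℕ) (s : State) : ℕ :=
  2 * (m - s.reg 13) + (if s.reg 9 = 0 then 0 else 1) +
    (m * L - ∑ e ∈ elts m k A, s.arr 4 e)

theorem AuctionState.lt_word (S : Setup W m k n A) (h : AuctionState m k A D L s) :
    s.reg 13 + 1 < W ∧ s.reg 9 + 1 < W ∧ s.reg 10 + 1 < W := by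
  have h1 := h.auc.cnt_le
  have h2 := h.auc.rp_le
  have hW : m + 1 < W := S.lt_word (by omega)
  refine ⟨by omega, ?_, by omega⟩
  rcases Nat.eq_zero_or_pos (s.reg 9) with h0 | h0
  · omega
  · have := (h.auc.hand_ok (s.reg 9 - 1) (by omega)).1
    omega

theorem wp_auctionStep (S : Setup W m k n A) (hD : ∀ r < m, D r ≤ min m k) (hL : L ≤ m)
    (h : AuctionState m k A D L s) (hrun : s.reg 13 < m ∨ s.reg 9 ≠ 0) :
    wp W auctionStep s fun s' t => AuctionState m k A D L s' ∧
      potential m k A L s' < potential m k A L s ∧ t ≤ 80 * m := by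
  have hm := S.pos
  have hn := S.le
  have hW : m + n + 1 < W := S.lt_word (by omega)
  obtain ⟨hw13, hw9, hw10⟩ := h.lt_word S
  have ha := h.auc
  rw [auctionStep, wp_cond]
  refine ⟨⟨by simp; omega, by simp; omega, ?_⟩, fun he => ?_, fun he => ?_⟩
  · simp only [Op.apply]
    split_ifs <;> omega
  · have h9 : s.reg 9 = 0 := by
      by_contra hn
      simp [hn] at he
    have h13 : s.reg 13 < m := by omega
    have hD13 := hD _ h13
    rw [h9] at ha
    rw [wp_comp, wp_cond]
    refine ⟨⟨by simp; omega, by simp [h.dist_eq]; omega⟩, fun he => ?_, fun he => ?_⟩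
    · have hd : D (s.reg 13) ≠ 0 := by simpa [h.dist_eq] using he
      simp only [wp_assign, wp_incr]
      refine ⟨by simp; omega, by simp; omega, ⟨h.toCtx.setReg.setReg, by simpa using h.root_eq,
        by simpa using h.dist_eq, by simpa using ha.call h13 hd⟩, ?_, by simp; omega⟩
      -- Calling a row creates a bidder, which costs one unit of potential; this is why uncalled
      -- rows are counted twice.
      simp [potential, h9]
      omega
    · have hd : D (s.reg 13) = 0 := by simpa [h.dist_eq] using he
      simp only [wp_skip, wp_incr]
      refine ⟨by omega, ⟨h.toCtx.setReg, by simpa using h.root_eq,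
        by simpa using h.dist_eq, by simpa [h9] using ha.skip h13 hd⟩, ?_, by simp; omega⟩
      simp [potential, h9]
      omega
  · have h9 : s.reg 9 ≠ 0 := by
      intro hn
      simp [hn] at he
    obtain ⟨r, hr⟩ : ∃ r, s.reg 9 = r + 1 := ⟨s.reg 9 - 1, by omega⟩
    rw [hr] at ha
    obtain ⟨hrp, hd, hheld, hU⟩ := ha.hand_ok r rfl
    have hrm : r < m := hrp.trans_le ha.rp_le
    have hDr := hD r hrm
    simp only [wp_comp, wp_assign]
    refine ⟨by simp; omega, by simp [h.dist_eq, hr]; omega, by simp [h.root_eq]; omega, ?_⟩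
    refine wp.frame_mono (wp_scan (d := D r - 1) (L := L) S (r := r) h.toCtx.setReg.setReg.setReg
      (by simp [hr]) hrm (by simp [h.dist_eq, hr]) (by omega) (by simp [h.root_eq]) hL
      (by simpa using ha.price_le)) ?_
    rintro s₁ t₁ ⟨⟨hle, hmin, hex⟩, ht₁⟩ hf
    have ec := h.toCtx.setReg.setReg.setReg.frame hf
    have e6 := hf.reg 6 (by decide)
    have e9 := hf.reg 9 (by decide)
    have e10 := hf.reg 10 (by decide)
    have e13 := hf.reg 13 (by decide)
    have e14 := hf.reg 14 (by decide)
    have a2 := hf.arr 2 (by decide)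
    have a3 := hf.arr 3 (by decide)
    have a4 := hf.arr 4 (by decide)
    have a5 := hf.arr 5 (by decide)
    simp [hr, h.root_eq] at e6 e9 e10 e13 e14 a2 a3 a4 a5 hmin hex
    have hmin' : ∀ e ∈ nbrs k A D r, s₁.reg 11 ≤ s.arr 4 e := by
      intro e he
      obtain ⟨c, hc, rfl⟩ := mem_nbrs.1 he
      exact hmin c (by omega)
    have hsum := ha.sum_price_le
    have ht : t₁ ≤ 28 * m + 6 := by omega
    rw [bid, wp_cond]
    by_cases hlt : s₁.reg 11 < L
    · refine ⟨by simp [e6, hlt]; omega, fun _ => ?_, fun he => by simp [e6, hlt] at he⟩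
      obtain ⟨c, hc, h12, hpc⟩ := hex hlt
      rw [← h12] at hpc
      have hb : s₁.reg 12 ∈ nbrs k A D r := mem_nbrs.2 ⟨c, by omega, h12.symm⟩
      have hbE := nbrs_subset hrm hDr hb
      have hbn := S.elt_lt hbE
      have hHb := ha.le hbE
      rw [← hpc] at hmin'
      have hauc := ha.bid hDr hb (hpc ▸ hlt) hmin'
      simp only [wp_comp, wp_assign, wp_store]
      refine ⟨by simp; omega, by simp; omega, by simp [a3]; omega, by simp; omega, by simp; omega,
        by simp [a3]; omega, ⟨ec.setArr.setReg.setArr.setReg, by simpa using e6,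
        by simpa [h.dist_eq] using a2, ?_⟩, ?_, by simp; omega⟩
      · simpa [a3, a4, a5, e9, e10, e13, ← hpc] using hauc
      -- The price sum after the bid is still at most `m * L`, so the truncated difference in the
      -- potential really drops by one. This pays even if the bidder is replaced by an evicted one.
      · have h1 := hauc.sum_price_le
        have h2 : ∑ e ∈ elts m k A, Function.update (s.arr 4) (s₁.reg 12)
            (s.arr 4 (s₁.reg 12) + 1) e = ∑ e ∈ elts m k A, s.arr 4 e + 1 := by
          rw [Finset.sum_update_of_mem hbE, Finset.sdiff_singleton_eq_erase,
            ← Finset.add_sum_erase _ _ hbE]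
          omega
        simp only [potential]
        simp [a4, e13, hr, ← hpc]
        rw [h2] at h1 ⊢
        split_ifs <;> omega
    · refine ⟨by simp [e6, hlt]; omega, fun he => by simp [e6, hlt] at he, fun _ => ?_⟩
      have hauc := ha.give_up fun e he => (not_lt.1 hlt).trans (hmin' e he)
      simp only [wp_comp, wp_assign, wp_store, wp_incr]
      refine ⟨by simp; omega, by simp; omega, by simp; omega, by simp; omega,
        ⟨ec.setArr.setReg.setReg, by simpa using e6, by simpa [h.dist_eq] using a2, ?_⟩, ?_,
        by simp; omega⟩
      · simpa [a3, a4, a5, e10, e13, e14] using hauc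
      · simp [potential, a4, e13, hr]

theorem wp_auction (S : Setup W m k n A) (hD : ∀ r < m, D r ≤ min m k) (hL : L ≤ m)
    (hL0 : 0 < L) (h : Ctx m k A s) (h6 : s.reg 6 = L) (h2 : s.arr 2 = D) :
    wp W auction s fun s' t => Ctx m k A s' ∧
      Auction m k A D L (s'.arr 3) (s'.arr 4) (s'.arr 5) m 0 (s'.reg 10) ∧
      t ≤ 400 * (m * m * L) := by
  have hm := S.pos
  have hn := S.le
  have hW : m + n + 2 < W := S.lt_word (by omega)
  rw [auction, wp_comp]
  refine wp.frame_mono (wp_clear S h (by decide)) ?_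
  rintro s₁ t₁ ⟨hz₁, ht₁⟩ hf₁
  have hc₁ := h.frame hf₁
  rw [wp_comp]
  refine wp.frame_mono (wp_clear S hc₁ (by decide)) ?_
  rintro s₂ t₂ ⟨hz₂, ht₂⟩ hf₂
  have hc₂ := hc₁.frame hf₂
  have a3 := hf₂.arr 3 (by decide)
  simp only [wp_comp, wp_assign]
  refine ⟨by simp; omega, by simp; omega, by simp; omega, ?_⟩
  -- Amortisation: each unit of potential pays for one auction step (at most `80 * m`) and one loop
  -- test (6). Initially the potential is `2 * m + m * L`.
  refine wp.mono (wp_loop (fun s t => AuctionState m k A D L s ∧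
      t + (80 * m + 6) * potential m k A L s ≤ (80 * m + 6) * (2 * m + m * L))
      (potential m k A L) ?_ ?_ ?_) ?_
  · refine ⟨⟨hc₂.setReg.setReg.setReg, ?_, ?_, ?_⟩, ?_⟩
    · simp [hf₂.reg 6 (by decide), hf₁.reg 6 (by decide), h6]
    · simp [hf₂.arr 2 (by decide), hf₁.arr 2 (by decide), h2]
    · simpa using Auction.init (by rw [a3]; exact hz₁) hz₂
    · rw [Nat.zero_add]
      refine Nat.mul_le_mul_left _ ?_
      simp [potential]
  · rintro s t ⟨h, -⟩
    obtain ⟨hw13, hw9, hw10⟩ := h.lt_word S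
    have := h.m_eq
    refine ⟨by simp; omega, ⟨by simp; omega, by simp; omega, ?_⟩, ?_⟩
    · simp only [Op.apply]
      split_ifs <;> omega
    · have := Op.lt_apply_le (s.reg 13) (s.reg 0)
      simp only [Expr.eval]
      rw [Op.apply]
      omega
  · rintro s t ⟨h, ht⟩ he
    refine wp.mono (wp_auctionStep S hD hL h ?_) ?_
    · by_contra hcon
      push Not at hcon
      simp [h.m_eq, hcon.2, not_lt.2 hcon.1] at he
    · rintro s' t' ⟨h1, h2, h3⟩
      refine ⟨⟨h1, ?_⟩, h2⟩
      have : (80 * m + 6) * (potential m k A L s' + 1) ≤ (80 * m + 6) * potential m k A L s :=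
        Nat.mul_le_mul_left _ h2
      rw [Nat.mul_succ] at this
      simp only [Expr.cost]
      omega
  · rintro s' t ⟨t₀, rfl, ⟨h1, h2⟩, he⟩
    have hrp := h1.auc.rp_le
    have h9 : s'.reg 9 = 0 := by
      by_contra hn
      simp [hn] at he
    have h13 : s'.reg 13 = m := by
      by_contra hn
      have hlt : s'.reg 13 < m := by omega
      simp [h9, h1.m_eq, hlt] at he
    have hauc := h1.auc
    rw [h13, h9] at hauc
    refine ⟨h1.toCtx, hauc, ?_⟩
    have h3 : t₀ ≤ (80 * m + 6) * (2 * m + m * L) := le_trans (Nat.le_add_right _ _) h2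
    have h4 : (80 * m + 6) * (2 * m + m * L) ≤ 86 * m * (3 * (m * L)) := by
      refine Nat.mul_le_mul (by omega) ?_
      have := Nat.mul_le_mul_left m hL0
      omega
    have h5 : m * m * 1 ≤ m * m * L := Nat.mul_le_mul_left _ hL0
    have h6 : 1 * 1 ≤ m * m := Nat.mul_le_mul hm hm
    have h7 : 86 * m * (3 * (m * L)) = 258 * (m * m * L) := by ring
    simp
    omega

end

/-! ### Augmenting paths -/

section

variable {m k : ℕ} {A D H vis qr qe qp : ℕ → ℕ} {r₀ tail found fe fi : ℕ}

/-- Assigning a free element to a row without an element. -/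
theorem IsPartial.add (h : IsPartial m k A D H) {e r : ℕ} (hr : r < m) (hn : e ∈ nbrs k A D r)
    (hE : e ∈ elts m k A) (hheld : ¬ Held m k A H r) (he : H e = 0) :
    IsPartial m k A D (Function.update H e (r + 1)) ∧
      ∀ r', Held m k A (Function.update H e (r + 1)) r' ↔ Held m k A H r' ∨ r' = r := by
  refine ⟨⟨fun b hb r' h' => ?_, fun b hb b' hb' heq h0 => ?_⟩, fun r' => ⟨?_, ?_⟩⟩
  · rw [Function.update_apply] at h'
    split_ifs at h' with h1
    · obtain rfl : r = r' := by omega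
      exact ⟨hr, h1 ▸ hn⟩
    · exact h.mem b hb r' h'
  · rw [Function.update_apply] at heq h0
    rw [Function.update_apply] at heq
    split_ifs at heq h0 with h1 h2 h2
    · rw [h1, h2]
    · exact absurd ⟨b', hb', heq.symm⟩ hheld
    · exact absurd ⟨b, hb, heq⟩ hheld
    · exact h.inj b hb b' hb' heq h0
  · rintro ⟨b, hb, h'⟩
    rw [Function.update_apply] at h'
    split_ifs at h' with h1
    · exact Or.inr (by omega)
    · exact Or.inl ⟨b, hb, h'⟩
  · rintro (⟨b, hb, h'⟩ | rfl)
    · refine ⟨b, hb, ?_⟩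
      rw [Function.update_of_ne, h']
      rintro rfl
      omega
    · exact ⟨e, hE, by simp⟩

/-- Taking an element from the row that holds it. -/
theorem IsPartial.remove (h : IsPartial m k A D H) {b r : ℕ} (hb : b ∈ elts m k A)
    (hbr : H b = r + 1) :
    IsPartial m k A D (Function.update H b 0) ∧
      ∀ r', Held m k A (Function.update H b 0) r' ↔ Held m k A H r' ∧ r' ≠ r := by
  refine ⟨⟨fun e he r' h' => ?_, fun e he e' he' heq h0 => ?_⟩, fun r' => ⟨?_, ?_⟩⟩
  · rw [Function.update_apply] at h'
    split_ifs at h' with h1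
    exact h.mem e he r' h'
  · rw [Function.update_apply] at heq h0
    rw [Function.update_apply] at heq
    split_ifs at heq h0 with h1 h2 h2
    · exact absurd heq h0
    · exact absurd rfl h0
    · exact absurd heq h0
    · exact h.inj e he e' he' heq h0
  · rintro ⟨e, he, h'⟩
    rw [Function.update_apply] at h'
    split_ifs at h' with h1
    refine ⟨⟨e, he, h'⟩, ?_⟩
    rintro rfl
    exact h1 (h.inj e he b hb (h'.trans hbr.symm) (by omega))
  · rintro ⟨⟨e, he, h'⟩, hne⟩
    refine ⟨e, he, ?_⟩
    rw [Function.update_of_ne, h']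
    rintro rfl
    omega

/-- Moving a row to a free element. -/
theorem IsPartial.move (h : IsPartial m k A D H) {e b r : ℕ} (hn : e ∈ nbrs k A D r)
    (hE : e ∈ elts m k A) (hb : b ∈ elts m k A) (hbr : H b = r + 1) (he : H e = 0) :
    IsPartial m k A D (Function.update (Function.update H e (r + 1)) b 0) ∧
      ∀ r', Held m k A (Function.update (Function.update H e (r + 1)) b 0) r' ↔
        Held m k A H r' := by
  have hne : e ≠ b := by
    rintro rfl
    omega
  obtain ⟨h1, h2⟩ := h.remove hb hbr
  have h3 := h1.add (h.mem b hb r hbr).1 hn hE (fun h4 => ((h2 r).1 h4).2 rfl)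
    (by rw [Function.update_of_ne hne, he])
  rw [Function.update_comm hne]
  refine ⟨h3.1, fun r' => ?_⟩
  rw [h3.2, h2]
  by_cases h4 : r' = r
  · subst h4
    simp only [ne_eq, not_true_eq_false, and_false, or_true, true_iff]
    exact ⟨b, hb, hbr⟩
  · simp [h4]

/-- The invariant of the search for an augmenting path from the row `r₀`: the queue has length
`tail` and holds rows `qr i`, which were reached through elements `qe i` from the queue items
`qp i`; if `found = 1`, the free element `fe` was reached from the queue item `fi`. -/
structure SearchTree (m k : ℕ) (A D H : ℕ → ℕ) (r₀ : ℕ) (vis qr qe qp : ℕ → ℕ)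
    (tail found fe fi : ℕ) : Prop where
  tail_pos : 0 < tail
  root : qr 0 = r₀
  node : ∀ i, 0 < i → i < tail → qe i ∈ elts m k A ∧ H (qe i) = qr i + 1 ∧ qp i < i ∧
    qe i ∈ nbrs k A D (qr (qp i))
  inj : ∀ i j, 0 < i → i < tail → 0 < j → j < tail → qe i = qe j → i = j
  vis_node : ∀ i, 0 < i → i < tail → vis (qe i) ≠ 0
  vis_le : ∀ e ∈ elts m k A, vis e ≤ 1
  visited : ∀ e ∈ elts m k A, vis e ≠ 0 →
    (H e = 0 ∧ found = 1) ∨ ∃ i, 0 < i ∧ i < tail ∧ qe i = e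
  found_le : found ≤ 1
  goal : found = 1 → fe ∈ elts m k A ∧ H fe = 0 ∧ fi < tail ∧ fe ∈ nbrs k A D (qr fi)

namespace SearchTree

theorem init (hv : ∀ e ∈ elts m k A, vis e = 0) (h0 : qr 0 = r₀) :
    SearchTree m k A D H r₀ vis qr qe qp 1 0 fe fi where
  tail_pos := Nat.one_pos
  root := h0
  node i h1 h2 := by omega
  inj i j h1 h2 := by omega
  vis_node i h1 h2 := by omega
  vis_le e he := by simp [hv e he]
  visited e he h := absurd (hv e he) h
  found_le := Nat.zero_le _
  goal h := by simp at h

theorem row_lt (h : SearchTree m k A D H r₀ vis qr qe qp tail found fe fi)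
    (hH : IsPartial m k A D H) (hr₀ : r₀ < m) {i : ℕ} (hi : i < tail) : qr i < m := by
  rcases Nat.eq_zero_or_pos i with rfl | h0
  · rw [h.root]
    exact hr₀
  · obtain ⟨h1, h2, -⟩ := h.node i h0 hi
    exact (hH.mem _ h1 _ h2).1

/-- Every queue item except the root holds the element through which it was reached. The root holds
nothing, and different elements have different holders. So the queue never has more than `m` items.
-/
theorem row_inj (h : SearchTree m k A D H r₀ vis qr qe qp tail found fe fi)
    (hH : IsPartial m k A D H) (hheld : ¬ Held m k A H r₀) {i j : ℕ} (hi : i < tail)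
    (hj : j < tail) (hij : qr i = qr j) : i = j := by
  have key : ∀ i, 0 < i → i < tail → qr i ≠ r₀ := fun i h0 hi heq => by
    obtain ⟨h1, h2, -⟩ := h.node i h0 hi
    exact hheld ⟨_, h1, by rw [h2, heq]⟩
  rcases Nat.eq_zero_or_pos i with rfl | hi0 <;> rcases Nat.eq_zero_or_pos j with rfl | hj0
  · rfl
  · exact absurd (hij.symm.trans h.root) (key j hj0 hj)
  · exact absurd (hij.trans h.root) (key i hi0 hi)
  · obtain ⟨h1, h2, -⟩ := h.node i hi0 hi
    obtain ⟨h3, h4, -⟩ := h.node j hj0 hj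
    exact h.inj i j hi0 hi hj0 hj (hH.inj _ h1 _ h3 (by rw [h2, h4, hij]) (by omega))

theorem tail_le (h : SearchTree m k A D H r₀ vis qr qe qp tail found fe fi)
    (hH : IsPartial m k A D H) (hheld : ¬ Held m k A H r₀) (hr₀ : r₀ < m) : tail ≤ m := by
  have := Finset.card_le_card_of_injOn (s := Finset.range tail) (t := Finset.range m) qr ?_ ?_
  · simpa using this
  · intro i hi
    simp only [Finset.coe_range, Set.mem_Iio] at hi ⊢
    exact h.row_lt hH hr₀ hi
  · intro i hi j hj hij
    simp only [Finset.coe_range, Set.mem_Iio] at hi hj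
    exact h.row_inj hH hheld hi hj hij

theorem push (h : SearchTree m k A D H r₀ vis qr qe qp tail found fe fi) {e head r : ℕ}
    (hE : e ∈ elts m k A) (hv : vis e = 0) (hr : H e = r + 1) (hhead : head < tail)
    (hn : e ∈ nbrs k A D (qr head)) :
    SearchTree m k A D H r₀ (Function.update vis e 1) (Function.update qr tail r)
      (Function.update qe tail e) (Function.update qp tail head) (tail + 1) found fe fi := by
  have hqr : ∀ i < tail, Function.update qr tail r i = qr i := fun i hi =>
    Function.update_of_ne hi.ne _ _
  have hqe : ∀ i < tail, Function.update qe tail e i = qe i := fun i hi =>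
    Function.update_of_ne hi.ne _ _
  have hqp : ∀ i < tail, Function.update qp tail head i = qp i := fun i hi =>
    Function.update_of_ne hi.ne _ _
  have hne : ∀ i, 0 < i → i < tail → qe i ≠ e := fun i h0 hi heq =>
    h.vis_node i h0 hi (heq ▸ hv)
  constructor
  · omega
  · rw [hqr 0 h.tail_pos, h.root]
  · intro i h0 hi
    rcases Nat.lt_succ_iff_lt_or_eq.1 hi with h1 | rfl
    · obtain ⟨h2, h3, h4, h5⟩ := h.node i h0 h1
      rw [hqe i h1, hqr i h1, hqp i h1, hqr _ (h4.trans h1)]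
      exact ⟨h2, h3, h4, h5⟩
    · simp only [Function.update_self]
      rw [hqr head hhead]
      exact ⟨hE, hr, hhead, hn⟩
  · intro i j hi0 hi hj0 hj hij
    rcases Nat.lt_succ_iff_lt_or_eq.1 hi with h1 | rfl <;>
      rcases Nat.lt_succ_iff_lt_or_eq.1 hj with h2 | rfl
    · rw [hqe i h1, hqe j h2] at hij
      exact h.inj i j hi0 h1 hj0 h2 hij
    · rw [hqe i h1, Function.update_self] at hij
      exact absurd hij (hne i hi0 h1)
    · rw [hqe j h2, Function.update_self] at hij
      exact absurd hij.symm (hne j hj0 h2)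
    · rfl
  · intro i h0 hi
    rcases Nat.lt_succ_iff_lt_or_eq.1 hi with h1 | rfl
    · rw [hqe i h1, Function.update_of_ne (hne i h0 h1)]
      exact h.vis_node i h0 h1
    · simp
  · intro e' he'
    rw [Function.update_apply]
    split_ifs
    · exact le_rfl
    · exact h.vis_le e' he'
  · intro e' he' hv'
    rw [Function.update_apply] at hv'
    split_ifs at hv' with h1
    · exact Or.inr ⟨tail, h.tail_pos, Nat.lt_succ_self _, by simp [h1]⟩
    · rcases h.visited e' he' hv' with h2 | ⟨i, h2, h3, h4⟩
      · exact Or.inl h2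
      · exact Or.inr ⟨i, h2, by omega, by rw [hqe i h3, h4]⟩
  · exact h.found_le
  · intro hf
    obtain ⟨h1, h2, h3, h4⟩ := h.goal hf
    rw [hqr fi h3]
    exact ⟨h1, h2, by omega, h4⟩

/-- A visited free element is never queued; `visited` allows this only together with `found = 1`.
After a failed search every visited element is therefore a `qe i`, which the counting in `not_sat`
relies on. -/
theorem reach (h : SearchTree m k A D H r₀ vis qr qe qp tail found fe fi) {e head : ℕ}
    (hE : e ∈ elts m k A) (he : H e = 0) (hhead : head < tail)
    (hn : e ∈ nbrs k A D (qr head)) :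
    SearchTree m k A D H r₀ (Function.update vis e 1) qr qe qp tail 1 e head where
  tail_pos := h.tail_pos
  root := h.root
  node := h.node
  inj := h.inj
  vis_node i h0 hi := by
    rw [Function.update_apply]
    split_ifs
    · exact one_ne_zero
    · exact h.vis_node i h0 hi
  vis_le e' he' := by
    rw [Function.update_apply]
    split_ifs
    · exact le_rfl
    · exact h.vis_le e' he'
  visited e' he' hv' := by
    rw [Function.update_apply] at hv'
    split_ifs at hv' with h1
    · exact Or.inl ⟨h1 ▸ he, rfl⟩
    · rcases h.visited e' he' hv' with h2 | h2
      · exact Or.inl ⟨h2.1, rfl⟩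
      · exact Or.inr h2
  found_le := le_rfl
  goal _ := ⟨hE, he, hhead, hn⟩

/-- If the search ends without success, Hall's condition fails. -/
theorem not_sat (h : SearchTree m k A D H r₀ vis qr qe qp tail 0 fe fi)
    (hH : IsPartial m k A D H) (hheld : ¬ Held m k A H r₀) (hr₀ : r₀ < m) (hd : D r₀ ≠ 0)
    (hD : ∀ r < m, D r ≤ min m k) (hdone : ∀ i < tail, ∀ e ∈ nbrs k A D (qr i), vis e ≠ 0) :
    ¬ Sat m k A D := by
  rintro ⟨σ, hσ, hσi⟩
  have hact : ∀ i < tail, D (qr i) ≠ 0 := fun i hi => by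
    rcases Nat.eq_zero_or_pos i with rfl | h0
    · rwa [h.root]
    · obtain ⟨h1, h2, -⟩ := h.node i h0 hi
      obtain ⟨c, hc, -⟩ := mem_nbrs.1 (hH.mem _ h1 _ h2).2
      omega
  -- Hall's count: the `tail` queued rows have all their neighbours among the `tail - 1` elements
  -- through which the non-root rows were reached.
  have := Finset.card_le_card_of_injOn (s := Finset.range tail)
    (t := (Finset.Ico 1 tail).image qe) (fun i => σ (qr i)) ?_ ?_
  · have h1 := this.trans Finset.card_image_le
    rw [Finset.card_range, Nat.card_Ico] at h1
    have := h.tail_pos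
    omega
  · intro i hi
    simp only [Finset.coe_range, Set.mem_Iio] at hi
    have h1 := h.row_lt hH hr₀ hi
    have h2 := hσ _ h1 (hact i hi)
    rcases h.visited _ (nbrs_subset h1 (hD _ h1) h2) (hdone i hi _ h2) with h3 | ⟨j, h3, h4, h5⟩
    · exact absurd h3.2 zero_ne_one
    · exact Finset.mem_coe.2 (Finset.mem_image.2 ⟨j, Finset.mem_Ico.2 ⟨h3, h4⟩, h5⟩)
  · intro i hi j hj hij
    simp only [Finset.coe_range, Set.mem_Iio] at hi hj
    exact h.row_inj hH hheld hi hj (hσi _ (h.row_lt hH hr₀ hi) _ (h.row_lt hH hr₀ hj)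
      (hact i hi) (hact j hj) hij)

end SearchTree

/-- The invariant of moving rows along the path found: the element `e` is to be given to the row
of the queue item `i`. -/
structure Flip (m k : ℕ) (A D H qr qe : ℕ → ℕ) (tail : ℕ) (H' : ℕ → ℕ) (e i : ℕ) : Prop where
  part : IsPartial m k A D (Function.update H' e 0)
  held : ∀ r, Held m k A (Function.update H' e 0) r ↔ Held m k A H r
  mem : e ∈ elts m k A
  lt : i < tail
  nbr : e ∈ nbrs k A D (qr i)
  rest : ∀ j, 0 < j → j ≤ i → Function.update H' e 0 (qe j) = qr j + 1

/-- `Flip` describes the matching with the cell of `e` erased. At the start `e` is the free goal, so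
erasing changes nothing. -/
theorem SearchTree.flip (h : SearchTree m k A D H r₀ vis qr qe qp tail 1 fe fi)
    (hH : IsPartial m k A D H) : Flip m k A D H qr qe tail H fe fi := by
  obtain ⟨h1, h2, h3, h4⟩ := h.goal rfl
  have h5 : Function.update H fe 0 = H := by
    rw [← h2, Function.update_eq_self]
  refine ⟨by rwa [h5], fun r => by rw [h5], h1, h3, h4, fun j h0 hj => ?_⟩
  rw [h5]
  exact (h.node j h0 (by omega)).2.1

namespace Flip

variable {H' : ℕ → ℕ} {e i : ℕ}

/-- Giving `e` to the row of item `i` makes that row's old element `qe i` available for the parent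
item. Its cell is not actually reset, since it will be overwritten next; only `Flip` reads it as
zero. Parents have smaller indices, so the cells `qe j` for items up to the parent are still
untouched. -/
theorem step (h : Flip m k A D H qr qe tail H' e i)
    (ht : SearchTree m k A D H r₀ vis qr qe qp tail found fe fi) (hi : 0 < i) :
    Flip m k A D H qr qe tail (Function.update H' e (qr i + 1)) (qe i) (qp i) := by
  obtain ⟨h1, h2, h3, h4⟩ := ht.node i hi h.lt
  have hbr := h.rest i hi le_rfl
  obtain ⟨h5, h6⟩ := h.part.move h.nbr h.mem h1 hbr (by simp)
  rw [Function.update_idem] at h5 h6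
  refine ⟨h5, fun r => (h6 r).trans (h.held r), h1, h3.trans h.lt, h4, fun j hj0 hj => ?_⟩
  have h7 := h.rest j hj0 (by omega)
  have h8 : qe j ≠ e := by
    intro h8
    simp [h8] at h7
  have h9 : qe j ≠ qe i := fun h9 => by
    have := ht.inj j i hj0 (by have := h.lt; omega) hi h.lt h9
    omega
  rw [Function.update_of_ne h8] at h7
  rw [Function.update_of_ne h9, Function.update_of_ne h8, h7]

theorem finish (h : Flip m k A D H qr qe tail H' e 0)
    (ht : SearchTree m k A D H r₀ vis qr qe qp tail found fe fi) (hr₀ : r₀ < m)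
    (hheld : ¬ Held m k A H r₀) :
    IsPartial m k A D (Function.update H' e (r₀ + 1)) ∧
      ∀ r, Held m k A (Function.update H' e (r₀ + 1)) r ↔ Held m k A H r ∨ r = r₀ := by
  have hn := h.nbr
  rw [ht.root] at hn
  have := h.part.add hr₀ hn h.mem (fun h1 => hheld ((h.held _).1 h1)) (by simp)
  rw [Function.update_idem] at this
  refine ⟨this.1, fun r => ?_⟩
  rw [this.2, h.held]

end Flip

end

/-! ### The search for augmenting paths on the machine -/

section

variable {W m k n : ℕ} {A D H : ℕ → ℕ} {r₀ : ℕ} {s : State}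

/-- Visit the element in row `14` and column `8`. -/
def visit : Prog :=
  .comp (.assign 23 (entryE 14 8)) (.cond (.load 6 (.reg 23)) .skip
    (.comp (.store 6 (.reg 23) (.const 1)) (.cond (.load 3 (.reg 23))
      (.comp (.store 7 (.reg 19) (.bin .sub (.load 3 (.reg 23)) (.const 1)))
        (.comp (.store 8 (.reg 19) (.reg 23)) (.comp (.store 9 (.reg 19) (.reg 18)) (incr 19))))
      (.comp (.assign 21 (.reg 23)) (.comp (.assign 22 (.reg 18)) (.assign 20 (.const 1)))))))

/-- Visit all elements that the next row of the queue prefers to `x`. -/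
def expand : Prog :=
  .comp (.assign 14 (.load 7 (.reg 18)))
    (.comp (.assign 15 (.bin .sub (.load 2 (.reg 14)) (.const 1)))
      (.comp (forLoop 8 15 visit) (incr 18)))

/-- Move rows along the path found. -/
def flipPath : Prog :=
  .comp (.loop (.reg 22) (.comp
      (.store 3 (.reg 21) (.bin .add (.load 7 (.reg 22)) (.const 1)))
      (.comp (.assign 21 (.load 8 (.reg 22))) (.assign 22 (.load 9 (.reg 22))))))
    (.store 3 (.reg 21) (.bin .add (.load 7 (.const 0)) (.const 1)))

/-- Search for an augmenting path from the row in register `17`, and use it. If there is none,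
register `4` is set to zero. -/
def search : Prog :=
  .comp (clear 6) (.comp (.store 7 (.const 0) (.reg 17)) (.comp (.assign 18 (.const 0))
    (.comp (.assign 19 (.const 1)) (.comp (.assign 20 (.const 0))
      -- With truth values `0` and `1`, `found < (head < tail)` says that nothing has been found and
      -- the queue is not exhausted.
      (.comp (.loop (.bin .lt (.reg 20) (.bin .lt (.reg 18) (.reg 19))) expand)
        (.cond (.reg 20) flipPath (.assign 4 (.const 0))))))))

/-- The invariant of the search in a machine state. -/
structure SearchState (m k : ℕ) (A D H : ℕ → ℕ) (r₀ : ℕ) (s : State) : Prop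
    extends Ctx m k A s where
  dist_eq : s.arr 2 = D
  hold_eq : s.arr 3 = H
  tree : SearchTree m k A D H r₀ (s.arr 6) (s.arr 7) (s.arr 8) (s.arr 9) (s.reg 19) (s.reg 20)
    (s.reg 21) (s.reg 22)

theorem SearchState.setReg (h : SearchState m k A D H r₀ s) {i v : ℕ} (h0 : i ≠ 0 := by decide)
    (h1 : i ≠ 1 := by decide) (h5 : i ≠ 5 := by decide) (h19 : i ≠ 19 := by decide)
    (h20 : i ≠ 20 := by decide) (h21 : i ≠ 21 := by decide) (h22 : i ≠ 22 := by decide) :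
    SearchState m k A D H r₀ (s.setReg i v) :=
  ⟨h.toCtx.setReg h0 h1 h5, h.dist_eq, h.hold_eq,
    by simpa [h19.symm, h20.symm, h21.symm, h22.symm] using h.tree⟩

/-- What a visit has to achieve: the invariant holds, the queue keeps its first entries, visited
elements stay visited, and the element `e` is visited. -/
structure Visited (m k : ℕ) (A D H : ℕ → ℕ) (r₀ : ℕ) (s s' : State) (e : ℕ) : Prop
    extends SearchState m k A D H r₀ s' where
  tail_mono : s.reg 19 ≤ s'.reg 19
  queue_eq : ∀ i < s.reg 19, s'.arr 7 i = s.arr 7 i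
  vis_mono : ∀ b, s.arr 6 b ≠ 0 → s'.arr 6 b ≠ 0
  done : s'.arr 6 e ≠ 0

theorem wp_visit (S : Setup W m k n A) (hD : ∀ r < m, D r ≤ min m k)
    (hH : IsPartial m k A D H) (hheld : ¬ Held m k A H r₀) (hr₀ : r₀ < m)
    (h : SearchState m k A D H r₀ s) {r c : ℕ} (hlt : s.reg 18 < s.reg 19)
    (h14 : s.reg 14 = r) (hr : s.arr 7 (s.reg 18) = r) (h8 : s.reg 8 = c) (hc : c + 1 < D r) :
    wp W visit s fun s' t => Visited m k A D H r₀ s s' (A (c + k * r)) ∧ t ≤ 40 := by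
  have hm := S.pos
  have hn := S.le
  have hW : m + n + 2 < W := S.lt_word (by omega)
  have htail := h.tree.tail_le hH hheld hr₀
  have hrm : r < m := hr ▸ h.tree.row_lt hH hr₀ hlt
  have hDr := hD r hrm
  have hnb : A (c + k * r) ∈ nbrs k A D (s.arr 7 (s.reg 18)) := by
    rw [hr]
    exact mem_nbrs.2 ⟨c, hc, rfl⟩
  have hE : A (c + k * r) ∈ elts m k A := mem_elts.2 ⟨r, hrm, c, by omega, rfl⟩
  have hEn := S.elt_lt hE
  have hv1 := h.tree.vis_le _ hE
  have hH1 := hH.le hE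
  have hfit := h.entryE_fits S (r := 14) (c := 8) (by omega) (by omega)
  have hev := h.entryE_eval (r := 14) (c := 8)
  rw [h14, h8] at hev
  rw [visit, wp_comp, wp_assign, hev, wp_cond]
  refine ⟨hfit, ⟨by simp; omega, by simp; omega⟩, fun he => ?_, fun he => ?_⟩
  · rw [wp_skip]
    exact ⟨⟨h.setReg, by simp, by simp, by simp, by simpa using he⟩, by simp⟩
  · have hv : s.arr 6 (A (c + k * r)) = 0 := by simpa using he
    rw [wp_comp, wp_store, wp_cond]
    refine ⟨by simp; omega, by simp; omega, ⟨by simp; omega, by simp [h.hold_eq]; omega⟩,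
      fun he => ?_, fun he => ?_⟩
    · have h0 : H (A (c + k * r)) ≠ 0 := by simpa [h.hold_eq] using he
      obtain ⟨q, hq⟩ : ∃ q, H (A (c + k * r)) = q + 1 := ⟨H (A (c + k * r)) - 1, by omega⟩
      simp only [wp_comp, wp_store, wp_incr]
      refine ⟨by simp; omega, by simp [h.hold_eq]; omega, by simp; omega, by simp; omega,
        by simp; omega, by simp; omega, by simp; omega,
        ⟨⟨h.toCtx.setReg.setArr.setArr.setArr.setArr.setReg, by simpa using h.dist_eq,
          by simpa using h.hold_eq, ?_⟩, by simp, ?_, ?_, by simp⟩, by simp⟩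
      · simpa [h.hold_eq, hq] using h.tree.push hE hv hq hlt hnb
      · intro i hi
        have : i ≠ s.reg 19 := hi.ne
        simp [this]
      · intro b hb
        by_cases h1 : b = A (c + k * r)
        · simp [h1]
        · simpa [h1] using hb
    · have h0 : H (A (c + k * r)) = 0 := by simpa [h.hold_eq] using he
      simp only [wp_comp, wp_assign]
      refine ⟨by simp; omega, by simp; omega, by simp; omega,
        ⟨⟨h.toCtx.setReg.setArr.setReg.setReg.setReg, by simpa using h.dist_eq,
          by simpa using h.hold_eq, ?_⟩, by simp, ?_, ?_, by simp⟩, by simp⟩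
      · simpa using h.tree.reach hE h0 hlt hnb
      · simp
      · intro b hb
        by_cases h1 : b = A (c + k * r)
        · simp [h1]
        · simpa [h1] using hb

theorem wp_expand (S : Setup W m k n A) (hD : ∀ r < m, D r ≤ min m k)
    (hH : IsPartial m k A D H) (hheld : ¬ Held m k A H r₀) (hr₀ : r₀ < m)
    (h : SearchState m k A D H r₀ s) (hlt : s.reg 18 < s.reg 19)
    (hdone : ∀ i < s.reg 18, ∀ e ∈ nbrs k A D (s.arr 7 i), s.arr 6 e ≠ 0) :
    wp W expand s fun s' t => SearchState m k A D H r₀ s' ∧ s'.reg 18 = s.reg 18 + 1 ∧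
      s'.reg 18 ≤ s'.reg 19 ∧
      (∀ i < s'.reg 18, ∀ e ∈ nbrs k A D (s'.arr 7 i), s'.arr 6 e ≠ 0) ∧ t ≤ 70 * m := by
  have hm := S.pos
  have hn := S.le
  have hW : m + n + 2 < W := S.lt_word (by omega)
  have htail := h.tree.tail_le hH hheld hr₀
  obtain ⟨r, hr⟩ : ∃ r, s.arr 7 (s.reg 18) = r := ⟨_, rfl⟩
  have hrm : r < m := hr ▸ h.tree.row_lt hH hr₀ hlt
  have hDr := hD r hrm
  rw [expand]
  simp only [wp_comp, wp_assign]
  refine ⟨by simp; omega, by simp [h.dist_eq, hr]; omega, ?_⟩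
  refine wp.frame_mono (wp_forLoop_uniform (N := D r - 1) (T := 40)
    (fun j s' => SearchState m k A D H r₀ s' ∧ s'.reg 14 = r ∧ s'.reg 18 = s.reg 18 ∧
      s.reg 18 < s'.reg 19 ∧ (∀ i ≤ s.reg 18, s'.arr 7 i = s.arr 7 i) ∧
      (∀ b, s.arr 6 b ≠ 0 → s'.arr 6 b ≠ 0) ∧ ∀ c < j, s'.arr 6 (A (c + k * r)) ≠ 0)
    (by decide) (by decide) (by decide) (by simp [h.dist_eq, hr]) (by omega)
    ⟨h.setReg.setReg.setReg, by simp [hr], by simp, by simpa using hlt, by simp, by simp,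
      by simp⟩ ?_) ?_
  · rintro j s' hj h8 - ⟨h1, h2, h3, h4, h5, h6, h7⟩
    refine wp.frame_mono (wp_visit S hD hH hheld hr₀ h1 (h3 ▸ h4) h2
      (by rw [h3, h5 _ le_rfl, hr]) h8 (by omega)) ?_
    rintro s₁ t₁ ⟨h9, ht⟩ hf
    have e14 := hf.reg 14 (by decide)
    have e18 := hf.reg 18 (by decide)
    refine ⟨⟨h9.toSearchState.setReg, by simp [e14, h2], by simp [e18, h3], ?_, ?_, ?_, ?_⟩, ht⟩
    · have := h9.tail_mono
      simp
      omega
    · intro i hi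
      exact (h9.queue_eq i (by omega)).trans (h5 i hi)
    · exact fun b hb => h9.vis_mono b (h6 b hb)
    · intro c hc
      rcases Nat.lt_succ_iff_lt_or_eq.1 hc with h | rfl
      · exact h9.vis_mono _ (h7 c h)
      · exact h9.done
  · rintro s₁ t₁ ⟨⟨h1, h2, h3, h4, h5, h6, h7⟩, ht⟩ -
    rw [wp_incr]
    refine ⟨by omega, h1.setReg, by simp [h3], by simp; omega, ?_, by simp; omega⟩
    intro i hi e he
    simp only [State.setReg_arr, State.setReg_reg, if_true, h3] at hi he ⊢
    rw [h5 i (by omega)] at he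
    rcases Nat.lt_succ_iff_lt_or_eq.1 hi with h | rfl
    · exact h6 e (hdone i h e he)
    · rw [hr] at he
      obtain ⟨c, hc, rfl⟩ := mem_nbrs.1 he
      exact h7 c (by omega)

theorem wp_flipPath (S : Setup W m k n A) (hH : IsPartial m k A D H)
    (hheld : ¬ Held m k A H r₀) (hr₀ : r₀ < m) (h : SearchState m k A D H r₀ s)
    (h20 : s.reg 20 = 1) :
    wp W flipPath s fun s' t => IsPartial m k A D (s'.arr 3) ∧
      (∀ r, Held m k A (s'.arr 3) r ↔ Held m k A H r ∨ r = r₀) ∧ t ≤ 40 * m := by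
  have hm := S.pos
  have hW : m + n + 2 < W := S.lt_word (by omega)
  have htree := h.tree
  rw [h20] at htree
  have htail := htree.tail_le hH hheld hr₀
  have hq0 := htree.root
  rw [flipPath, wp_comp]
  -- The item index in register `22` strictly decreases along parents and starts below `tail ≤ m`;
  -- it serves both as variant and as time budget.
  refine wp.mono (wp_loop (fun s' t => s'.arr 7 = s.arr 7 ∧ s'.arr 8 = s.arr 8 ∧
    s'.arr 9 = s.arr 9 ∧ Flip m k A D H (s.arr 7) (s.arr 8) (s.reg 19) (s'.arr 3) (s'.reg 21)
      (s'.reg 22) ∧ t + 20 * s'.reg 22 ≤ 20 * m)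
    (fun s => s.reg 22) ⟨rfl, rfl, rfl, ?_, ?_⟩ ?_ ?_) ?_
  · rw [h.hold_eq]
    exact htree.flip hH
  · have := (htree.goal rfl).2.2.1
    omega
  · rintro s' t ⟨-, -, -, h1, -⟩
    have := h1.lt
    simp
    omega
  · rintro s' t ⟨a7, a8, a9, h1, ht⟩ he
    have hi : 0 < s'.reg 22 := Nat.pos_of_ne_zero (by simpa using he)
    have h2 := h1.lt
    have h3 := S.elt_lt h1.mem
    have h4 := htree.row_lt hH hr₀ h2
    obtain ⟨h5, -, h6, -⟩ := htree.node _ hi h2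
    have h7 := S.elt_lt h5
    simp only [wp_comp, wp_assign, wp_store]
    refine ⟨by simp; omega, by simp [a7]; omega, by simp [a8]; omega, by simp [a9]; omega,
      ⟨by simp [a7], by simp [a8], by simp [a9], ?_, ?_⟩, ?_⟩
    · simpa [a7, a8, a9] using h1.step htree hi
    · simp [a9]
      omega
    · simpa [a9] using h6
  · rintro s' t ⟨t₀, rfl, ⟨a7, a8, a9, h1, ht⟩, he⟩
    have h22 : s'.reg 22 = 0 := by simpa using he
    have h3 := S.elt_lt h1.mem
    rw [h22] at h1
    have h4 := h1.finish htree hr₀ hheld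
    rw [wp_store]
    refine ⟨by simp; omega, by simp [a7, hq0]; omega, ?_, ?_, by simp; omega⟩
    · simpa [a7, hq0] using h4.1
    · simpa [a7, hq0] using h4.2

theorem wp_search (S : Setup W m k n A) (hD : ∀ r < m, D r ≤ min m k) (h : Ctx m k A s)
    (h2 : s.arr 2 = D) (hH : IsPartial m k A D (s.arr 3)) (h17 : s.reg 17 = r₀) (hr₀ : r₀ < m)
    (hd : D r₀ ≠ 0) (hheld : ¬ Held m k A (s.arr 3) r₀) :
    wp W search s fun s' t => ((s'.reg 4 = s.reg 4 ∧ IsPartial m k A D (s'.arr 3) ∧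
      ∀ r, Held m k A (s'.arr 3) r ↔ Held m k A (s.arr 3) r ∨ r = r₀) ∨
      (s'.reg 4 = 0 ∧ ¬ Sat m k A D)) ∧ t ≤ 200 * (m * m) := by
  have hm := S.pos
  have hW : m + n + 2 < W := S.lt_word (by omega)
  have hmm : m * 1 ≤ m * m := Nat.mul_le_mul_left _ hm
  rw [search, wp_comp]
  refine wp.frame_mono (wp_clear S h (by decide)) ?_
  rintro s₁ t₁ ⟨hz, ht₁⟩ hf₁
  have hc₁ := h.frame hf₁
  have e17 := hf₁.reg 17 (by decide)
  have e4 := hf₁.reg 4 (by decide)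
  have a2 := hf₁.arr 2 (by decide)
  have a3 := hf₁.arr 3 (by decide)
  rw [← a3] at hH hheld ⊢
  rw [← e4]
  simp only [wp_comp, wp_assign, wp_store]
  refine ⟨by simp; omega, by simp; omega, by simp; omega, by simp; omega, by simp; omega, ?_⟩
  -- Each round expands one queue item in at most `70 * m` steps, plus 6 for the test, and at most
  -- `m` items can be expanded.
  refine wp.frame_mono (wp_loop (fun s t => SearchState m k A D (s₁.arr 3) r₀ s ∧
      s.reg 18 ≤ s.reg 19 ∧
      (∀ i < s.reg 18, ∀ e ∈ nbrs k A D (s.arr 7 i), s.arr 6 e ≠ 0) ∧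
      t + (70 * m + 6) * (m - s.reg 18) ≤ (70 * m + 6) * m)
      (fun s => m - s.reg 18) ⟨⟨hc₁.setArr.setReg.setReg.setReg, ?_, ?_, ?_⟩, ?_, ?_, ?_⟩
      ?_ ?_) ?_
  · simp [a2, h2]
  · simp
  · simpa using SearchTree.init hz (by simp [e17, h17])
  · simp
  · simp
  · simp
  · rintro s' t ⟨h1, h3, -, -⟩
    have h4 := h1.tree.found_le
    have h5 := h1.tree.tail_le hH hheld hr₀
    refine ⟨by simp; omega, ⟨by simp; omega, by simp; omega, ?_⟩, ?_⟩
    · exact (Op.lt_apply_le _ _).trans_lt (by omega)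
    · exact (Op.lt_apply_le _ _).trans_lt (by omega)
  · rintro s' t ⟨h1, h3, h4, ht⟩ he
    have h5 := h1.tree.tail_le hH hheld hr₀
    have hlt : s'.reg 18 < s'.reg 19 := by
      by_contra hn
      simp [hn] at he
    refine wp.mono (wp_expand S hD hH hheld hr₀ h1 hlt h4) ?_
    rintro s'' t' ⟨h6, h7, h8, h9, ht'⟩
    refine ⟨⟨h6, h8, h9, ?_⟩, by omega⟩
    have h10 : m - s'.reg 18 = (m - s''.reg 18) + 1 := by omega
    rw [h10, Nat.mul_succ] at ht
    simp only [Expr.cost]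
    omega
  · rintro s' t ⟨t₀, rfl, ⟨h1, h3, h4, ht⟩, he⟩ hf
    have e4 := hf.reg 4 (by decide)
    simp at e4
    have h5 := h1.tree.found_le
    have hmul : (70 * m + 6) * m ≤ 76 * (m * m) := by
      rw [Nat.add_mul, Nat.mul_assoc]
      omega
    have ht0 : t₀ ≤ 76 * (m * m) := by omega
    rw [wp_cond]
    refine ⟨by simp; omega, fun h20 => ?_, fun h20 => ?_⟩
    · have h20 : s'.reg 20 ≠ 0 := by simpa using h20
      refine wp.frame_mono (wp_flipPath S hH hheld hr₀ h1 (by omega)) ?_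
      rintro s'' t' ⟨h6, h7, ht'⟩ hf'
      refine ⟨Or.inl ⟨?_, h6, h7⟩, ?_⟩
      · rw [hf'.reg 4 (by decide), e4]
      · simp
        omega
    · have h20 : s'.reg 20 = 0 := by simpa using h20
      rw [wp_assign]
      refine ⟨by simp; omega, Or.inr ⟨by simp, ?_⟩, by simp; omega⟩
      have htree := h1.tree
      rw [h20] at htree
      refine htree.not_sat hH hheld hr₀ hd hD fun i hi => h4 i ?_
      by_contra hn
      have hlt : s'.reg 18 < s'.reg 19 := by omega
      simp [h20, hlt] at he

end

/-! ### Deciding avoidability -/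

section

variable {W m k n : ℕ} {A D : ℕ → ℕ} {L x : ℕ} {s : State}

/-- Decide whether all rows that list `x` can be matched to elements that they prefer to `x`;
the answer is left in register `4`. -/
def decideCore : Prog :=
  .comp distances (.comp auction (.comp (.assign 4 (.const 1))
    (.cond (.bin .lt (.reg 0) (.bin .mul (.reg 10) (.reg 6))) (.assign 4 (.const 0))
      (forLoop 24 10 (.cond (.reg 4) (.comp (.assign 17 (.load 5 (.reg 24))) search) .skip)))))

/-- Auction and searches are balanced: the auction costs `O(m * m * L)` and leaves either a
refutation or at most `L` rows, for each of which one search costs `O(m * m)`. -/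
theorem wp_decideCore (S : Setup W m k n A) (hL : IsRoot m L) (h : Ctx m k A s)
    (h6 : s.reg 6 = L) (h3 : s.reg 3 = x) (hx : x < n) :
    wp W decideCore s fun s' t => (∃ D : ℕ → ℕ, (∀ r < m, IsDist m k A x r (D r)) ∧
      ((s'.reg 4 = 1 ∧ Sat m k A D) ∨ (s'.reg 4 = 0 ∧ ¬ Sat m k A D))) ∧
      t ≤ 1000 * (m * m * L) := by
  have hm := S.pos
  have hL0 := hL.pos
  have hW : m + n + 2 < W := S.lt_word (by omega)
  have hmm : m * 1 ≤ m * m := Nat.mul_le_mul_left _ hm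
  have hmmL : m * m * 1 ≤ m * m * L := Nat.mul_le_mul_left _ hL0
  rw [decideCore, wp_comp]
  refine wp.frame_mono (wp_distances S h h3 hx) ?_
  rintro s₁ t₁ ⟨hd, ht₁⟩ hf₁
  have hc₁ := h.frame hf₁
  have hD : ∀ r < m, s₁.arr 2 r ≤ min m k := fun r hr => (hd r hr).le
  obtain ⟨D, hDe⟩ : ∃ D, s₁.arr 2 = D := ⟨_, rfl⟩
  rw [hDe] at hd hD
  rw [wp_comp]
  refine wp.frame_mono (wp_auction S hD hL.le hL0 hc₁
    ((hf₁.reg 6 (by decide)).trans h6) hDe) ?_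
  rintro s₂ t₂ ⟨hc₂, ha, ht₂⟩ hf₂
  have e6 : s₂.reg 6 = L := by rw [hf₂.reg 6 (by decide), hf₁.reg 6 (by decide), h6]
  have a2 : s₂.arr 2 = D := by rw [hf₂.arr 2 (by decide), hDe]
  have hcnt := ha.cnt_le
  have hLm := hL.le
  have hmulW : s₂.reg 10 * L < W := S.mul_lt_word (by omega) (by omega)
  rw [wp_comp, wp_assign, wp_cond]
  refine ⟨by simp; omega, ⟨by simp [hc₂.m_eq]; omega, ⟨by simp; omega, by simp; omega, by simpa [e6]⟩,
    (Op.lt_apply_le _ _).trans_lt (by omega)⟩, fun he => ?_, fun he => ?_⟩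
  · have hlt : m < s₂.reg 10 * L := by
      by_contra hn
      simp [hc₂.m_eq, e6, hn] at he
    rw [wp_assign]
    refine ⟨by simp; omega, ⟨D, hd, Or.inr ⟨by simp, fun hs => ?_⟩⟩, by simp; omega⟩
    exact absurd (ha.cnt_mul_le hD hs) (not_le.2 hlt)
  · have hlt : s₂.reg 10 * L ≤ m := by
      by_contra hn
      simp [hc₂.m_eq, e6, not_le.1 hn] at he
    -- From `cnt * L ≤ m ≤ L * L`. This is where `L` has to be the square root rounded up.
    have hcntL : s₂.reg 10 ≤ L := Nat.le_of_mul_le_mul_right (hlt.trans hL.le_sq) hL0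
    -- While register `4` is `1`, the active rows without an element are exactly the rows from index
    -- `j` on in the list of those that gave up. Once a search has failed, register `4` is `0` and
    -- the remaining rounds do nothing.
    refine wp.frame_mono (wp_forLoop_uniform (N := s₂.reg 10) (T := 200 * (m * m) + 10)
      (fun j s => Ctx m k A s ∧ s.arr 2 = D ∧ s.arr 5 = s₂.arr 5 ∧
        ((s.reg 4 = 1 ∧ IsPartial m k A D (s.arr 3) ∧
          (∀ r < m, D r ≠ 0 → Held m k A (s.arr 3) r ∨
            ∃ i, j ≤ i ∧ i < s₂.reg 10 ∧ s₂.arr 5 i = r) ∧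
          ∀ i, j ≤ i → i < s₂.reg 10 → ¬ Held m k A (s.arr 3) (s₂.arr 5 i)) ∨
        (s.reg 4 = 0 ∧ ¬ Sat m k A D)))
      (by decide) (by decide) (by decide) (by simp) (by omega)
      ⟨hc₂.setReg.setReg, by simpa using a2, by simp, Or.inl ⟨by simp, by simpa using
        ha.toIsPartial, ?_, ?_⟩⟩ ?_) ?_
    · intro r hr hdr
      rcases ha.cover r hr hdr with h1 | h1 | ⟨i, h1, h2⟩
      · exact Or.inl h1
      · omega
      · exact Or.inr ⟨i, Nat.zero_le _, h1, h2⟩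
    · exact fun i _ hi => (ha.gave_up i hi).2.2.1
    · rintro j s hj h24 - ⟨hc, h2, h5, hor⟩
      rw [wp_cond]
      rcases hor with ⟨h4, hH, hcov, hun⟩ | ⟨h4, hns⟩
      · refine ⟨by simp; omega, fun _ => ?_, fun he => by simp [h4] at he⟩
        obtain ⟨hU1, hU2, -, -⟩ := ha.gave_up j hj
        rw [wp_comp, wp_assign]
        refine ⟨by simp [h5, h24]; omega, ?_⟩
        refine wp.frame_mono (wp_search (r₀ := s₂.arr 5 j) S hD hc.setReg (by simpa using h2)
          (by simpa using hH) (by simp [h5, h24]) hU1 hU2 (hun j le_rfl hj)) ?_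
        rintro s' t ⟨hres, ht⟩ hf
        have hc' := hc.setReg.frame hf
        have b2 := hf.arr 2 (by decide)
        have b5 := hf.arr 5 (by decide)
        simp at b2 b5 hres
        refine ⟨⟨hc'.setReg, by simp [b2, h2], by simp [b5, h5], ?_⟩, by simp; omega⟩
        rcases hres with ⟨h7, h8, h9⟩ | ⟨h7, h8⟩
        · refine Or.inl ⟨by simp [h7, h4], h8, fun r hr hdr => ?_, fun i hi hi' => ?_⟩
          · rcases hcov r hr hdr with h1 | ⟨i, h1, h10, h11⟩
            · exact Or.inl ((h9 r).2 (Or.inl h1))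
            · rcases Nat.eq_or_lt_of_le h1 with rfl | h1
              · exact Or.inl ((h9 r).2 (Or.inr h11.symm))
              · exact Or.inr ⟨i, h1, h10, h11⟩
          · intro hheld
            rcases (h9 _).1 hheld with h1 | h1
            · exact hun i (by omega) hi' h1
            · have := ha.gave_up_inj i hi' j hj h1
              omega
        · exact Or.inr ⟨by simpa using h7, h8⟩
      · refine ⟨by simp; omega, fun he => by simp [h4] at he, fun _ => ?_⟩
        rw [wp_skip]
        exact ⟨⟨hc.setReg, by simpa using h2, by simpa using h5, Or.inr ⟨by simpa using h4, hns⟩⟩,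
          by simp⟩
    · rintro s' t ⟨⟨-, -, -, hor⟩, ht⟩ -
      refine ⟨⟨D, hd, ?_⟩, ?_⟩
      · rcases hor with ⟨h4, hH, hcov, -⟩ | h4
        · refine Or.inl ⟨h4, hH.sat fun r hr hdr => ?_⟩
          rcases hcov r hr hdr with h1 | ⟨i, h1, h2, -⟩
          · exact h1
          · omega
        · exact Or.inr h4
      · have h7 := Nat.mul_le_mul_right (200 * (m * m) + 10 + 8) hcntL
        have h8 : L * (200 * (m * m) + 10 + 8) ≤ L * (218 * (m * m)) :=
          Nat.mul_le_mul_left _ (by omega)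
        have h9 : L * (218 * (m * m)) = 218 * (m * m * L) := by ring
        simp
        omega

end

/-! ### From the machine's arrays back to the preference matrix -/

section

variable {m k n : ℕ} (M : PrefMatrix m k n)

theorem inputState_arr_zero (y : ℕ) {r c : ℕ} (hr : r < m) (hc : c < k) :
    (inputState M y).arr 0 (c + k * r) = M.entry ⟨r, hr⟩ ⟨c, hc⟩ := by
  have hlt : c + k * r < m * k := by
    have := (finProdFinEquiv (⟨r, hr⟩, (⟨c, hc⟩ : Fin k))).2
    simpa using this
  have h : finProdFinEquiv.symm ⟨c + k * r, hlt⟩ = ((⟨r, hr⟩ : Fin m), (⟨c, hc⟩ : Fin k)) := by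
    rw [Equiv.symm_apply_eq]
    ext
    simp
  simp only [inputState, hlt, and_self, dite_true, h]

theorem setup_of_prefMatrix (y : ℕ) (hm : 0 < m) (hn : 0 < n) :
    Setup ((m + n) ^ 6) m k n ((inputState M y).arr 0) where
  pos := hm
  entry_lt r c hr hc := by
    rw [inputState_arr_zero M y hr hc]
    exact Fin.is_lt _
  row_inj r c c' hr hc hc' h := by
    rw [inputState_arr_zero M y hr hc, inputState_arr_zero M y hr hc'] at h
    simpa using M.row_injective _ (Fin.ext h)
  le := by simpa using Fintype.card_le_of_injective _ (M.row_injective ⟨0, hm⟩)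
  word := by
    -- Both `m` and `n` are positive, so the base is at least 2 and four of the six factors already
    -- contribute 16, enough to absorb the lower-order terms.
    obtain ⟨N, hN⟩ : ∃ N, m + n = N + 2 := ⟨m + n - 2, by omega⟩
    rw [hN]
    have h1 : 16 ≤ (N + 2) ^ 4 := Nat.pow_le_pow_left (by omega : 2 ≤ N + 2) 4
    have h2 : (N + 2) ^ 6 = (N + 2) ^ 4 * ((N + 2) * (N + 2)) := by ring
    have h3 := Nat.mul_le_mul_right ((N + 2) * (N + 2)) h1
    nlinarith

/-- Translation between columns and elements: within a row the entries are distinct, so choosing an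
element before `x` is the same as choosing a column before that of `x`. The word `y` does not affect
array `0`; it is kept so that both the decision input and the listing input are covered. -/
theorem sat_iff_avoidable (y : ℕ) (x : Fin n) {D : ℕ → ℕ}
    (hD : ∀ r < m, IsDist m k ((inputState M y).arr 0) x r (D r)) :
    Sat m k ((inputState M y).arr 0) D ↔ Avoidable M x := by
  have hA : ∀ (r : Fin m) (c : Fin k), (inputState M y).arr 0 (c + k * r) = M.entry r c :=
    fun r c => inputState_arr_zero M y r.2 c.2
  have hDx : ∀ (r : Fin m) (c : Fin k), (c : ℕ) < min m k → M.entry r c = x → D r = c + 1 := by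
    intro r c hc hx
    rcases hD r r.2 with ⟨-, h⟩ | ⟨c', hc', h, hd⟩
    · exact absurd (by rw [hA, hx]) (h c hc)
    · have h1 : M.entry r ⟨c', by omega⟩ = x := Fin.ext (by rw [← h, ← hA])
      have h2 := M.row_injective r (h1.trans hx.symm)
      rw [hd, ← h2]
  have hDe : ∀ r : Fin m, D r ≠ 0 → ∃ c : Fin k, (c : ℕ) < min m k ∧ M.entry r c = x := by
    intro r hr
    rcases hD r r.2 with ⟨h, -⟩ | ⟨c, hc, h, -⟩
    · exact absurd h hr
    · exact ⟨⟨c, by omega⟩, hc, Fin.ext (by rw [← h, ← hA])⟩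
  -- For `k = 0` both sides hold trivially, while `Saturable` fails for lack of a function into `Fin
  -- 0`.
  rcases Nat.eq_zero_or_pos k with hk | hk
  · refine ⟨fun _ => avoidable_of_forall_ne fun r c => absurd c.2 (by omega), fun _ => ?_⟩
    have h0 : ∀ r < m, D r = 0 := fun r hr => by
      have := (hD r hr).le
      omega
    exact ⟨fun _ => 0, fun r hr h => absurd (h0 r hr) h, fun r hr _ _ h => absurd (h0 r hr) h⟩
  rw [avoidable_iff_saturable hk]
  constructor
  · rintro ⟨σ, h1, h2⟩
    have : ∀ r : Fin m, ∃ c : Fin k, D r ≠ 0 → (c : ℕ) + 1 < D r ∧ (M.entry r c : ℕ) = σ r := by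
      intro r
      by_cases hr : D r = 0
      · exact ⟨⟨0, hk⟩, fun h => absurd hr h⟩
      · obtain ⟨c, hc, hc'⟩ := mem_nbrs.1 (h1 r r.2 hr)
        have := (hD r r.2).le
        exact ⟨⟨c, by omega⟩, fun _ => ⟨hc, by rw [← hA, hc']⟩⟩
    choose f hf using this
    refine ⟨f, fun r c hc hx => ?_, fun r r' c c' hc hx hc' hx' he => ?_⟩
    · have h3 := hDx r c hc hx
      have := (hf r (by omega)).1
      rw [Fin.lt_def]
      omega
    · have h3 := hDx r c hc hx
      have h4 := hDx r' c' hc' hx'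
      have h5 := (hf r (by omega)).2
      have h6 := (hf r' (by omega)).2
      exact Fin.ext (h2 r r.2 r' r'.2 (by omega) (by omega) (by rw [← h5, ← h6, he]))
  · rintro ⟨σ, h1, h2⟩
    refine ⟨fun r => if hr : r < m then M.entry ⟨r, hr⟩ (σ ⟨r, hr⟩) else 0,
      fun r hr hd => ?_, fun r hr r' hr' hd hd' he => ?_⟩
    · obtain ⟨c, hc, hx⟩ := hDe ⟨r, hr⟩ hd
      have h3 := hDx _ c hc hx
      have h4 := h1 _ c hc hx
      rw [Fin.lt_def] at h4
      simp only at h3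
      simp only [hr, dite_true]
      exact mem_nbrs.2 ⟨σ ⟨r, hr⟩, by omega, hA ⟨r, hr⟩ _⟩
    · obtain ⟨c, hc, hx⟩ := hDe ⟨r, hr⟩ hd
      obtain ⟨c', hc', hx'⟩ := hDe ⟨r', hr'⟩ hd'
      simp only [hr, hr', dite_true] at he
      simpa using h2 _ _ c c' hc hx hc' hx' (Fin.ext he)

theorem wp_decideCore_avoidable {s : State} {L : ℕ} (y : ℕ) (hm : 0 < m) (hL : IsRoot m L)
    (h : Ctx m k ((inputState M y).arr 0) s) (h6 : s.reg 6 = L) (x : Fin n) (h3 : s.reg 3 = x) :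
    wp ((m + n) ^ 6) decideCore s fun s' t =>
      ((s'.reg 4 = 1 ∧ Avoidable M x) ∨ (s'.reg 4 = 0 ∧ ¬ Avoidable M x)) ∧
        t ≤ 1000 * (m * m * L) := by
  refine wp.mono (wp_decideCore (setup_of_prefMatrix M y hm x.pos) hL h h6 h3 x.2) ?_
  rintro s' t ⟨⟨D, hD, hor⟩, ht⟩
  rw [sat_iff_avoidable M y x hD] at hor
  exact ⟨hor, ht⟩

/-- Decide whether the element in register `3` is avoidable. -/
def decideProg : Prog := .comp prepare (.comp decideCore (.assign 0 (.reg 4)))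

theorem wp_decideProg (hm : 0 < m) (x : Fin n) :
    wp ((m + n) ^ 6) decideProg (inputState M x) fun s t =>
      ((Avoidable M x ∧ s.reg 0 = 1) ∨ (¬ Avoidable M x ∧ s.reg 0 = 0)) ∧
        ∃ L, IsRoot m L ∧ t ≤ 1100 * (m * m * L) := by
  have hn := x.pos
  have S := setup_of_prefMatrix M x hm hn
  have hW : 1 < (m + n) ^ 6 := S.lt_word (by omega)
  rw [decideProg, wp_comp]
  refine wp.frame_mono (wp_prepare S (s := inputState M x) rfl rfl rfl) ?_
  rintro s₁ t₁ ⟨hc, hL, ht₁⟩ hf₁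
  rw [wp_comp]
  refine wp.mono (wp_decideCore_avoidable M x hm hL hc rfl x (hf₁.reg 3 (by decide))) ?_
  rintro s₂ t₂ ⟨hor, ht₂⟩
  have hL0 := hL.pos
  have hmm : m * 1 ≤ m * m := Nat.mul_le_mul_left _ hm
  have hmmL : m * m * 1 ≤ m * m * s₁.reg 6 := Nat.mul_le_mul_left _ hL0
  rw [wp_assign]
  refine ⟨?_, ?_, _, hL, by simp; omega⟩
  · rcases hor with ⟨h, -⟩ | ⟨h, -⟩ <;> simp [h] <;> omega
  · rcases hor with ⟨h, h'⟩ | ⟨h, h'⟩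
    · exact Or.inl ⟨h', by simpa using h⟩
    · exact Or.inr ⟨h', by simpa using h⟩

/-- Both `L - 1` and `1` are at most `√(m + n)`, which gives the factor 2. -/
theorem IsRoot.le_sqrt {L : ℕ} (h : IsRoot m L) (n : ℕ) :
    (L : ℝ) ≤ 2 * Real.sqrt ((m : ℝ) + (n : ℝ)) := by
  have h1 : ((L : ℝ) - 1) * ((L : ℝ) - 1) ≤ m := by
    have h2 : (((L - 1 : ℕ) : ℝ)) * ((L - 1 : ℕ) : ℝ) ≤ m := by exact_mod_cast h.sq_lt.le
    rwa [Nat.cast_sub h.pos, Nat.cast_one] at h2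
  have hm : (1 : ℝ) ≤ m := by exact_mod_cast h.pos.trans_le h.le
  have hn : (0 : ℝ) ≤ n := Nat.cast_nonneg n
  have h3 : (L : ℝ) - 1 ≤ Real.sqrt ((m : ℝ) + n) := Real.le_sqrt_of_sq_le (by nlinarith)
  have h4 : 1 ≤ Real.sqrt ((m : ℝ) + n) := Real.le_sqrt_of_sq_le (by nlinarith)
  linarith

end

/-! ### Listing the unavoidable elements -/

section

variable {m k n : ℕ} (M : PrefMatrix m k n)

theorem unavoidable_iff_not_avoidable {M : PrefMatrix m k n} {b : Fin n} :
    Unavoidable M b ↔ ¬ Avoidable M b := by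
  simp [Unavoidable, Avoidable]

/-- Treat the element in row `25` and column `26`, if it has not been treated before. -/
def listStep : Prog :=
  .comp (.assign 3 (entryE 25 26)) (.cond (.load 10 (.reg 3)) .skip
    (.comp (.store 10 (.reg 3) (.const 1)) (.comp decideCore (.cond (.reg 4) .skip
      (.comp (.store 1 (.reg 27) (.reg 3)) (incr 27))))))

/-- List the unavoidable elements. -/
def listProg : Prog :=
  .comp prepare (.comp (forLoop 25 0 (forLoop 26 5 listStep)) (.assign 0 (.reg 27)))

/-- The invariant of the listing: array `10` marks the elements treated so far, and the unavoidable
ones among them are listed in array `1`. -/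
structure ListState (M : PrefMatrix m k n) (A : ℕ → ℕ) (L : ℕ) (s : State) : Prop
    extends Ctx m k A s where
  root_eq : s.reg 6 = L
  mark_le : ∀ e, s.arr 10 e ≤ 1
  mark_mem : ∀ e, s.arr 10 e ≠ 0 → e ∈ elts m k A
  list : ∃ l : List (Fin n), l.Nodup ∧ (∀ b : Fin n, b ∈ l ↔ s.arr 10 b ≠ 0 ∧ Unavoidable M b) ∧
    s.reg 27 = l.length ∧ ∀ (i : ℕ) (hi : i < l.length), s.arr 1 i = (l[i] : ℕ)

variable {M} in
theorem ListState.setReg {A : ℕ → ℕ} {L : ℕ} {s : State} (h : ListState M A L s) {i v : ℕ}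
    (h0 : i ≠ 0 := by decide) (h1 : i ≠ 1 := by decide) (h5 : i ≠ 5 := by decide)
    (h6 : i ≠ 6 := by decide) (h27 : i ≠ 27 := by decide) : ListState M A L (s.setReg i v) :=
  ⟨h.toCtx.setReg h0 h1 h5, by simpa [h6.symm] using h.root_eq, h.mark_le, h.mark_mem,
    by simpa [h27.symm] using h.list⟩

/-- The number of elements treated so far. -/
def marked (m k : ℕ) (A : ℕ → ℕ) (s : State) : ℕ := ∑ e ∈ elts m k A, s.arr 10 e

/-- The time bound is amortised: a new element raises `marked` by one and thereby pays for a whole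
decision, while a repeated element costs at most 12 steps. -/
theorem wp_listStep {s : State} {L r c : ℕ} (hm : 0 < m) (hn : 0 < n) (hL : IsRoot m L)
    (h : ListState M ((inputState M 0).arr 0) L s) (h25 : s.reg 25 = r) (hr : r < m)
    (h26 : s.reg 26 = c) (hc : c < min m k) :
    wp ((m + n) ^ 6) listStep s fun s' t =>
      ListState M ((inputState M 0).arr 0) L s' ∧
      (∀ e, s.arr 10 e ≠ 0 → s'.arr 10 e ≠ 0) ∧
      s'.arr 10 ((inputState M 0).arr 0 (c + k * r)) ≠ 0 ∧
      t + marked m k ((inputState M 0).arr 0) s * (1000 * (m * m * L) + 40) ≤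
        marked m k ((inputState M 0).arr 0) s' * (1000 * (m * m * L) + 40) + 12 := by
  have S := setup_of_prefMatrix M 0 hm hn
  obtain ⟨A, hA⟩ : ∃ A, (inputState M 0).arr 0 = A := ⟨_, rfl⟩
  have hdec := fun (s : State) => wp_decideCore_avoidable (s := s) M 0 hm hL
  rw [hA] at S h hdec ⊢
  obtain ⟨W, hWe⟩ : ∃ W, (m + n) ^ 6 = W := ⟨_, rfl⟩
  rw [hWe] at S hdec ⊢
  have hW : m + n + 2 < W := S.lt_word (by omega)
  have hE : A (c + k * r) ∈ elts m k A := mem_elts.2 ⟨r, hr, c, hc, rfl⟩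
  have hEn := S.elt_lt hE
  have hfit := h.entryE_fits S (r := 25) (c := 26) (by omega) (by omega)
  have hev := h.entryE_eval (r := 25) (c := 26)
  rw [h25, h26] at hev
  have hle := h.mark_le (A (c + k * r))
  rw [listStep, wp_comp, wp_assign, hev, wp_cond]
  refine ⟨hfit, ⟨by simp; omega, by simp; omega⟩, fun he => ?_, fun he => ?_⟩
  · rw [wp_skip]
    refine ⟨h.setReg, by simp, by simpa using he, ?_⟩
    simp [marked]
    omega
  · have h0 : s.arr 10 (A (c + k * r)) = 0 := by simpa using he
    obtain ⟨b, hb⟩ : ∃ b : Fin n, (b : ℕ) = A (c + k * r) := ⟨⟨_, hEn⟩, rfl⟩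
    rw [wp_comp, wp_store]
    refine ⟨by simp; omega, by simp; omega, ?_⟩
    rw [wp_comp]
    refine wp.frame_mono (hdec _ h.toCtx.setReg.setArr (by simpa using h.root_eq) b
      (by simp [hb])) ?_
    rintro s₁ t₁ ⟨hor, ht₁⟩ hf
    have hc₁ := h.toCtx.setReg.setArr.frame hf
    have e6 := hf.reg 6 (by decide)
    have e27 := hf.reg 27 (by decide)
    have e3 := hf.reg 3 (by decide)
    have a10 := hf.arr 10 (by decide)
    have a1 := hf.arr 1 (by decide)
    simp [h.root_eq] at e6 e27 e3 a10 a1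
    obtain ⟨l, hl1, hl2, hl3, hl4⟩ := h.list
    have hbl : b ∉ l := fun hbl => ((hl2 b).1 hbl).1 (hb ▸ h0)
    have hlen : l.length + 1 ≤ n := by
      have := (List.nodup_cons.2 ⟨hbl, hl1⟩).length_le_card
      simpa using this
    have hmark_le : ∀ e, s₁.arr 10 e ≤ 1 := fun e => by
      rw [a10, Function.update_apply]
      split_ifs
      · exact le_rfl
      · exact h.mark_le e
    have hmark_mem : ∀ e, s₁.arr 10 e ≠ 0 → e ∈ elts m k A := fun e => by
      rw [a10, Function.update_apply]
      split_ifs with h1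
      · exact fun _ => h1 ▸ hE
      · exact h.mark_mem e
    have hmono : ∀ e, s.arr 10 e ≠ 0 → s₁.arr 10 e ≠ 0 := fun e he => by
      rw [a10, Function.update_apply]
      split_ifs
      · exact one_ne_zero
      · exact he
    have hdone : s₁.arr 10 (A (c + k * r)) ≠ 0 := by simp [a10]
    have hsum : marked m k A s₁ = marked m k A s + 1 := by
      rw [marked, marked, a10, Finset.sum_update_of_mem hE, Finset.sdiff_singleton_eq_erase,
        ← Finset.add_sum_erase _ _ hE]
      omega
    have hmem : ∀ b' : Fin n, b' ≠ b → (s₁.arr 10 b' ≠ 0 ↔ s.arr 10 b' ≠ 0) := fun b' hb' => by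
      rw [a10, Function.update_of_ne]
      rw [← hb]
      exact fun h1 => hb' (Fin.ext h1)
    have htime : ∀ s' : State, s'.arr 10 = s₁.arr 10 → ∀ t, t ≤ t₁ + 40 →
        t + marked m k A s * (1000 * (m * m * L) + 40) ≤
          marked m k A s' * (1000 * (m * m * L) + 40) + 12 := by
      intro s' hs' t ht
      have : marked m k A s' = marked m k A s + 1 := by
        rw [← hsum, marked, marked, hs']
      rw [this, Nat.add_mul, Nat.one_mul]
      omega
    rw [wp_cond]
    rcases hor with ⟨h4, hav⟩ | ⟨h4, hav⟩
    · refine ⟨by simp; omega, fun _ => ?_, fun he => by simp [h4] at he⟩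
      rw [wp_skip]
      refine ⟨⟨hc₁, e6, hmark_le, hmark_mem, l, hl1, fun b' => ?_, by rw [e27, hl3],
        by rwa [a1]⟩, hmono, hdone, htime _ rfl _ (by simp; omega)⟩
      by_cases hb' : b' = b
      · subst hb'
        simp [hbl, unavoidable_iff_not_avoidable, hav]
      · rw [hl2, hmem b' hb']
    · refine ⟨by simp; omega, fun he => by simp [h4] at he, fun _ => ?_⟩
      rw [wp_comp, wp_store, wp_incr]
      refine ⟨by simp; omega, by simp; omega, by simp; omega,
        ⟨hc₁.setArr.setReg, by simpa using e6, by simpa using hmark_le, by simpa using hmark_mem,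
          l ++ [b], ?_, fun b' => ?_, by simp [e27, hl3], fun i hi => ?_⟩,
        by simpa using hmono, by simpa using hdone, htime _ (by simp) _ (by simp; omega)⟩
      · refine List.nodup_append.2 ⟨hl1, by simp, fun a ha b' hb' h1 => hbl ?_⟩
        rwa [← List.mem_singleton.1 hb', ← h1]
      · simp only [List.mem_append, List.mem_singleton, State.setReg_arr, State.setArr_arr]
        by_cases hb' : b' = b
        · subst hb'
          simp [unavoidable_iff_not_avoidable, hav, hb, hdone]
        · simp [hl2, hb', hmem b' hb']
      · simp only [State.setReg_arr, State.setArr_arr, if_true, Expr.eval, e27, e3, a1, hl3]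
        rw [List.length_append, List.length_singleton] at hi
        rcases Nat.lt_succ_iff_lt_or_eq.1 hi with h1 | rfl
        · rw [Function.update_of_ne h1.ne, List.getElem_append_left h1, hl4 i h1]
        · simp [hb]

/-- `N` is the number of distinct elements in the first `min m k` columns. The summand in `N + 1`
pays for the preparation and for passing over all positions. -/
theorem wp_listProg (hm : 0 < m) (hn : 0 < n) :
    wp ((m + n) ^ 6) listProg (inputState M 0) fun s t =>
      (∃ l : List (Fin n), l.Nodup ∧ (∀ b, b ∈ l ↔ Unavoidable M b) ∧
        s.reg 0 = l.length ∧ ∀ (i : ℕ) (hi : i < l.length), s.arr 1 i = (l[i] : ℕ)) ∧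
      ∃ L N, IsRoot m L ∧ N ≤ n ∧ N ≤ m * m ∧ t ≤ 1100 * (m * m * L) * (N + 1) := by
  have S := setup_of_prefMatrix M 0 hm hn
  have hW : m + n + 2 < (m + n) ^ 6 := S.lt_word (by omega)
  rw [listProg, wp_comp]
  refine wp.frame_mono (wp_prepare S (s := inputState M 0) rfl rfl rfl) ?_
  rintro s₁ t₁ ⟨hc, hL, ht₁⟩ hf₁
  have e27 : s₁.reg 27 = 0 := hf₁.reg 27 (by decide)
  have a10 : s₁.arr 10 = fun _ => 0 := (hf₁.arr 10 (by decide)).trans (by simp [inputState])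
  obtain ⟨L, hLe⟩ : ∃ L, s₁.reg 6 = L := ⟨_, rfl⟩
  have hstep := fun (s : State) (r c : ℕ) => wp_listStep (s := s) (L := L) (r := r) (c := c) M hm hn
  obtain ⟨A, hA⟩ : ∃ A, (inputState M 0).arr 0 = A := ⟨_, rfl⟩
  have hAx : ∀ (r : Fin m) (c : Fin k), A (c + k * r) = M.entry r c := fun r c => by
    rw [← hA]
    exact inputState_arr_zero M 0 r.2 c.2
  rw [hLe] at hL
  rw [hA] at S hc hstep
  rw [wp_comp]
  obtain ⟨T, hT⟩ : ∃ T, 1000 * (m * m * L) + 40 = T := ⟨_, rfl⟩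
  rw [hT] at hstep
  have hk : min m k ≤ m := min_le_left m k
  -- `T` is charged per marked element. Apart from that, a position costs 20 = 12 + 8 (a repeated
  -- element and the loop overhead), and a row 14 = 6 + 8 for its two loops.
  refine wp.mono (wp_forLoop (N := m) (fun i s t => ListState M A L s ∧
      (∀ r < i, ∀ c < min m k, s.arr 10 (A (c + k * r)) ≠ 0) ∧
      t ≤ marked m k A s * T + i * (20 * m + 14))
    (by decide) (by decide) (by decide) hc.m_eq (by omega)
    ⟨⟨hc.setReg, by simpa using hLe, by simp [a10], by simp [a10], [], by simp [a10, e27]⟩,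
      by simp, by simp⟩ ?_) ?_
  · rintro i s t hi h25 - ⟨h, hz, ht⟩
    -- The inner loop counts its time from zero, so the time `t` of the earlier rows enters its
    -- invariant as a constant.
    refine wp.mono (wp_forLoop (N := min m k) (fun j s t' => ListState M A L s ∧ s.reg 25 = i ∧
        (∀ r < i, ∀ c < min m k, s.arr 10 (A (c + k * r)) ≠ 0) ∧
        (∀ c < j, s.arr 10 (A (c + k * i)) ≠ 0) ∧
        t + t' ≤ marked m k A s * T + i * (20 * m + 14) + 20 * j)
      (by decide) (by decide) (by decide) h.min_eq (by omega)
      ⟨h.setReg, by simpa using h25, by simpa using hz, by simp,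
        by simpa [marked] using ht⟩ ?_) ?_
    · rintro j s t' hj h26 - ⟨h, h25, hz, hz', ht⟩
      refine wp.frame_mono (hstep s i j hL h h25 hi h26 hj) ?_
      rintro s' t'' ⟨h1, h2, h3, h4⟩ hf
      refine ⟨h1.setReg, ?_, fun r hr c hcc => h2 _ (hz r hr c hcc), fun c hcc => ?_, ?_⟩
      · simpa [hf.reg 25 (by decide)] using h25
      · rcases Nat.lt_succ_iff_lt_or_eq.1 hcc with h5 | rfl
        · exact h2 _ (hz' c h5)
        · exact h3
      · have : marked m k A (s'.setReg 26 (j + 1)) = marked m k A s' := rfl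
        rw [this]
        omega
    · rintro s' t' ⟨t₀, rfl, h1, h2, h3, h4, h5⟩
      refine ⟨h1.setReg, fun r hr c hcc => ?_, ?_⟩
      · rcases Nat.lt_succ_iff_lt_or_eq.1 hr with h6 | rfl
        · exact h3 r h6 c hcc
        · exact h4 c hcc
      · have : marked m k A (s'.setReg 25 (i + 1)) = marked m k A s' := rfl
        rw [this, Nat.succ_mul]
        omega
  · rintro s₂ t₂ ⟨t₀, rfl, h1, h2, ht⟩
    obtain ⟨l, hl1, hl2, hl3, hl4⟩ := h1.list
    have hlen : l.length ≤ n := by simpa using hl1.length_le_card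
    rw [wp_assign]
    refine ⟨by simp; omega, ⟨l, hl1, fun b => ?_, by simp [hl3], hl4⟩, L, (elts m k A).card, hL,
      ?_, ?_, ?_⟩
    · rw [hl2]
      refine ⟨fun h => h.2, fun h => ⟨?_, h⟩⟩
      -- An element never marked does not occur in the first columns, hence is avoidable.
      by_contra hb
      refine unavoidable_iff_not_avoidable.1 h (avoidable_of_forall_ne fun r c hcc hx => ?_)
      refine h2 r r.2 c hcc ?_
      rw [hAx, hx]
      exact hb
    · have := Finset.card_le_card (s := elts m k A) (t := Finset.range n)
        fun e he => Finset.mem_range.2 (S.elt_lt he)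
      simpa using this
    · refine Finset.card_image_le.trans ?_
      rw [Finset.card_product, Finset.card_range, Finset.card_range]
      exact Nat.mul_le_mul_left _ hk
    · have hmk : marked m k A s₂ ≤ (elts m k A).card := by
        have := Finset.sum_le_card_nsmul (elts m k A) (s₂.arr 10) 1 fun e _ => h1.mark_le e
        simpa [marked] using this
      have h3 := Nat.mul_le_mul_right T hmk
      have hmm : m * 1 ≤ m * m := Nat.mul_le_mul_left _ hm
      have hmmL : m * m * 1 ≤ m * m * L := Nat.mul_le_mul_left _ hL.pos
      have h4 : (elts m k A).card * T ≤ (elts m k A).card * (1100 * (m * m * L)) :=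
        Nat.mul_le_mul_left _ (by omega)
      have h5 : m * (20 * m + 14) = 20 * (m * m) + 14 * m := by ring
      rw [Nat.mul_succ, Nat.mul_comm (1100 * (m * m * L))]
      simp
      omega

end

/-! ### The four time bounds -/

theorem decideProg_decidesAvoidable_sqrt :
    DecidesAvoidable decideProg
      fun m n => (m : ℝ) ^ 2 * Real.sqrt ((m : ℝ) + (n : ℝ)) := by
  refine ⟨2200, 6, fun m k n hm M x => ?_⟩
  obtain ⟨t, s, hx, hor, L, hL, ht⟩ := wp_decideProg M hm x
  refine ⟨t, s, hx, ?_, hor⟩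
  have h1 := hL.le_sqrt n
  have h2 : (t : ℝ) ≤ 1100 * (m * m * L) := by exact_mod_cast ht
  have h3 : (m : ℝ) * m * L ≤ m * m * (2 * Real.sqrt ((m : ℝ) + (n : ℝ))) := by gcongr
  linarith

theorem decideProg_decidesAvoidable_cube :
    DecidesAvoidable decideProg fun m _ => (m : ℝ) ^ 3 := by
  refine ⟨1100, 6, fun m k n hm M x => ?_⟩
  obtain ⟨t, s, hx, hor, L, hL, ht⟩ := wp_decideProg M hm x
  refine ⟨t, s, hx, ?_, hor⟩
  have h1 : (L : ℝ) ≤ m := by exact_mod_cast hL.le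
  have h2 : (t : ℝ) ≤ 1100 * (m * m * L) := by exact_mod_cast ht
  have h3 : (m : ℝ) * m * L ≤ m * m * m := by gcongr
  linarith

theorem listProg_listsUnavoidable_sqrt :
    ListsUnavoidable listProg
      fun m n => (m : ℝ) ^ 2 * (n : ℝ) * Real.sqrt ((m : ℝ) + (n : ℝ)) := by
  refine ⟨4400, 6, fun m k n hm hn M => ?_⟩
  obtain ⟨t, s, hx, hl, L, N, hL, hN, -, ht⟩ := wp_listProg M hm hn
  refine ⟨t, s, hx, ?_, hl⟩
  have h1 := hL.le_sqrt n
  have h2 : (t : ℝ) ≤ 1100 * (m * m * L) * (N + 1) := by exact_mod_cast ht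
  -- Here `0 < n` is used; together with the factor 2 of `IsRoot.le_sqrt` this gives 4400 = 4 *
  -- 1100.
  have h3 : (N : ℝ) + 1 ≤ 2 * n := by
    have : N + 1 ≤ 2 * n := by omega
    exact_mod_cast this
  have h4 : (m : ℝ) * m * L * (N + 1) ≤
      m * m * (2 * Real.sqrt ((m : ℝ) + (n : ℝ))) * (2 * n) := by gcongr
  linarith

theorem listProg_listsUnavoidable_pow :
    ListsUnavoidable listProg fun m _ => (m : ℝ) ^ 5 := by
  refine ⟨2200, 6, fun m k n hm hn M => ?_⟩
  obtain ⟨t, s, hx, hl, L, N, hL, -, hN, ht⟩ := wp_listProg M hm hn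
  refine ⟨t, s, hx, ?_, hl⟩
  have h1 : (L : ℝ) ≤ m := by exact_mod_cast hL.le
  have h2 : (t : ℝ) ≤ 1100 * (m * m * L) * (N + 1) := by exact_mod_cast ht
  have h3 : (N : ℝ) + 1 ≤ 2 * (m * m) := by
    have h5 := Nat.mul_le_mul hm hm
    have : N + 1 ≤ 2 * (m * m) := by omega
    exact_mod_cast this
  have h4 : (m : ℝ) * m * L * (N + 1) ≤ m * m * m * (2 * (m * m)) := by gcongr
  linarith

end HouseAllocation

theorem mainTheorem8 :
    (∃ p : HouseAllocation.Prog,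
      HouseAllocation.DecidesAvoidable p (fun m n => (m : ℝ) ^ 2 * Real.sqrt ((m : ℝ) + (n : ℝ)))) ∧
    (∃ p : HouseAllocation.Prog,
      HouseAllocation.DecidesAvoidable p (fun m _ => (m : ℝ) ^ 3)) ∧
    (∃ p : HouseAllocation.Prog,
      HouseAllocation.ListsUnavoidable p
        (fun m n => (m : ℝ) ^ 2 * (n : ℝ) * Real.sqrt ((m : ℝ) + (n : ℝ)))) ∧
    (∃ p : HouseAllocation.Prog,
      HouseAllocation.ListsUnavoidable p (fun m _ => (m : ℝ) ^ 5)) :=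
  ⟨⟨_, HouseAllocation.decideProg_decidesAvoidable_sqrt⟩,
    ⟨_, HouseAllocation.decideProg_decidesAvoidable_cube⟩,
    ⟨_, HouseAllocation.listProg_listsUnavoidable_sqrt⟩,
    ⟨_, HouseAllocation.listProg_listsUnavoidable_pow⟩⟩
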